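/- Let $\mathbb A$ be a real alternative (possibly non-associative) algebra with unit $1$, of finite dimension $d+1>1$, with a real-linear anti-involution $a\mapsto a^c$ (that is, $(a^c)^c=a$, $(ab)^c=b^ca^c$, and $r^c=r$ for $r\in\mathbb R=\mathbb R1$). Put $t(a)=a+a^c$, $n(a)=aa^c$, $\mathbb S_{\mathbb A}=\{a: t(a)=0,\ n(a)=1\}$ and $Q_{\mathbb A}=\mathbb R\cup\{a: t(a)\in\mathbb R,\ n(a)\in\mathbb R,\ 4n(a)>t(a)^2\}$. Let $M$ be a real subspace with $\mathbb R\subsetneq M\subseteq Q_{\mathbb A}$, with a basis $(v_0,\dots,v_m)$, $m\ge1$, such that $v_0=1$, $v_s\in\mathbb S_{\mathbb A}$ for $s\geq 1$, and $v_sv_t=-v_tv_s$ for distinct $s,t\ge1$; complete it to a real basis $(v_0,\dots,v_d)$ of $\mathbb A$. Identify $x=(x_1,\dots,x_n)\in M^n$, $x_j=\sum_{s=0}^m x_{j,s}v_s$, with the point $(x_{j,s})$ of $\mathbb R^{(m+1)n}$. For $k\in\mathbb N\cup\{\infty\}$ let $C_0^k(M^n,\mathbb A)$ be the set of compactly supported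 functions $M^n\to\mathbb A$ whose real components in the basis $(v_0,\dots,v_d)$ are $C^k$; derivatives and integrals of $\mathbb A$-valued functions are taken componentwise. Put $$\overline\partial_j=\sum_{s=0}^m v_s\,\frac{\partial}{\partial x_{j,s}},\qquad \partial_j=\sum_{s=0}^m v_s^c\,\frac{\partial}{\partial x_{j,s}},\qquad \Delta_j=\sum_{s=0}^m\frac{\partial^2}{\partial x_{j,s}^2},$$ with the coefficients $v_s$, $v_s^c$ multiplying from the left, and $$E(y)=\frac1{\sigma_{m+1}}\frac{y^c}{|y|^{m+1}}\quad (y\in M\setminus\{0\}),\qquad \sigma_{m+1}=\frac{2\,\Gamma(1/2)^{m+1}}{\Gamma((m+1)/2)},$$ where $|\cdot|$ is the Euclidean norm in the coordinates of the basis. Theorem. Let $n>1$, $k\in\mathbb N\cup\{\infty\}$, $k\ge3$, and $g_1,\dots,g_n\in C_0^k(M^n,\mathbb A)$. The following three statements are equivalent. (i) The system $\overline\partial_jf=g_j$, $j=1,\dots,n$, has a solution $f\in C_0^k(M^n,\mathbb A)$ that vanishes on the unbounded component of $M^n\setminus(\operatorname{supp}g_1\cup\dots\cup\operatorname{supp}g_n)$.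 (ii) For $j=2,\dots,n$ and all $x=(x_1,x^0)=(x_1,x_2,\dots,x_n)\in M^n$, $$g_j(x)=-\overline\partial_j\Big(\int_M E(y_1)\,g_1(y_1+x_1,x^0)\,dy_1\Big),$$ where $dy_1$ is Lebesgue measure on $M\cong\mathbb R^{m+1}$ and $\overline\partial_j$ is taken with respect to $x$. (iii) For all $i,j=1,\dots,n$, $\overline\partial_i(\partial_jg_j)=\Delta_jg_i$ on $M^n$. Furthermore, every solution $f\in C_0^k(M^n,\mathbb A)$ of the system in (i) vanishes on the unbounded component of $M^n\setminus(\operatorname{supp}g_1\cup\dots\cup\operatorname{supp}g_n)$. -/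

import Mathlib

open MeasureTheory

/-- A (not necessarily associative) ring is alternative if it satisfies the left and the right
alternative law. -/
class IsAlternative (A : Type*) [NonUnitalNonAssocRing A] : Prop where
  left_alt : ∀ x y : A, x * (x * y) = (x * x) * y
  right_alt : ∀ x y : A, (y * x) * x = y * (x * x)

section Hypercomplex

variable {A : Type*} [NonAssocRing A] [Module ℝ A] [StarRing A]

/-- The trace `t(x) = x + xᶜ`, where `xᶜ = star x`. -/
def starTrace (x : A) : A := x + star x

/-- The squared norm `n(x) = x xᶜ`. -/
def starNorm (x : A) : A := x * star x

variable (A) in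
/-- The sphere `𝕊_A` of imaginary units. -/
def imaginaryUnits : Set A := {x | starTrace x = 0 ∧ starNorm x = 1}

variable (A) in
/-- The quadratic cone `Q_A`; the real line inside `A` is `ℝ • 1`. -/
def quadraticCone : Set A :=
  {x | ∃ r : ℝ, x = r • (1 : A)} ∪
  {x | ∃ t n : ℝ, starTrace x = t • (1 : A) ∧ starNorm x = n • (1 : A) ∧ t ^ 2 < 4 * n}

/-- `M` is a hypercomplex subspace of `A`: `ℝ ⊊ M ⊆ Q_A`. -/
def IsHypercomplexSubspace (M : Submodule ℝ A) : Prop :=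
  Submodule.span ℝ {(1 : A)} < M ∧ (M : Set A) ⊆ quadraticCone A

/-- `(v₀, …, v_m)` is a hypercomplex basis of `M`. -/
structure IsHypercomplexBasis {m : ℕ} (M : Submodule ℝ A) (v : Fin (m + 1) → A) : Prop where
  one_le : 1 ≤ m
  linearIndependent : LinearIndependent ℝ v
  span_eq : Submodule.span ℝ (Set.range v) = M
  zero_eq_one : v 0 = 1
  mem_imaginaryUnits : ∀ s, s ≠ 0 → v s ∈ imaginaryUnits A
  anticomm : ∀ s t, s ≠ 0 → t ≠ 0 → s ≠ t → v s * v t = -(v t * v s)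

end Hypercomplex

/-- The coordinate space `(ℝ^{m+1})ⁿ`, identified with `Mⁿ` through a hypercomplex basis: the point
`x` has coordinates `x j s`, and stands for `(x₁, …, x_n)` with `x_j = ∑ s, x j s • v s`. -/
abbrev HyperSpace (n m : ℕ) : Type := Fin n → EuclideanSpace ℝ (Fin (m + 1))

section Functions

variable {A : Type*} [NonAssocRing A] [Module ℝ A] {n m d : ℕ}

/-- `f ∈ C^k`: all the real components of `f` in the basis `b` of `A` are `C^k`. -/
def IsCk (b : Module.Basis (Fin (d + 1)) ℝ A) (k : ℕ∞) (f : HyperSpace n m → A) : Prop :=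
  ∀ t, ContDiff ℝ k (fun x => b.repr (f x) t)

/-- `f ∈ C_0^k(Mⁿ, A)`. -/
def IsCkCompact (b : Module.Basis (Fin (d + 1)) ℝ A) (k : ℕ∞) (f : HyperSpace n m → A) : Prop :=
  IsCk b k f ∧ HasCompactSupport f

/-- The partial derivative `∂f/∂x_{j,s} = ∑ t, (∂f_t/∂x_{j,s}) v_t`. -/
noncomputable def partialD (b : Module.Basis (Fin (d + 1)) ℝ A) (j : Fin n) (s : Fin (m + 1))
    (f : HyperSpace n m → A) (x : HyperSpace n m) : A :=
  ∑ t, lineDeriv ℝ (fun y => b.repr (f y) t) x (Pi.single j (EuclideanSpace.single s 1)) • b t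

/-- The Dirac (Cauchy–Riemann) operator `∂̄_j f = ∑ s, v_s ∂f/∂x_{j,s}`. -/
noncomputable def dirac (b : Module.Basis (Fin (d + 1)) ℝ A) (v : Fin (m + 1) → A) (j : Fin n)
    (f : HyperSpace n m → A) (x : HyperSpace n m) : A :=
  ∑ s, v s * partialD b j s f x

/-- The conjugated Dirac operator `∂_j f = ∑ s, v_sᶜ ∂f/∂x_{j,s}`. -/
noncomputable def conjDirac [StarRing A] (b : Module.Basis (Fin (d + 1)) ℝ A)
    (v : Fin (m + 1) → A) (j : Fin n) (f : HyperSpace n m → A) (x : HyperSpace n m) : A :=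
  ∑ s, star (v s) * partialD b j s f x

/-- The Laplacian `Δ_j` in the `j`-th variable. -/
noncomputable def laplacianAt (b : Module.Basis (Fin (d + 1)) ℝ A) (j : Fin n)
    (f : HyperSpace n m → A) (x : HyperSpace n m) : A :=
  ∑ s : Fin (m + 1), partialD b j s (partialD b j s f) x

/-- The area of the unit sphere of `ℝ^{m+1}`. -/
noncomputable def sphereArea (m : ℕ) : ℝ :=
  2 * Real.Gamma (1 / 2) ^ (m + 1) / Real.Gamma (((m : ℝ) + 1) / 2)

/-- The Cauchy kernel `E(y) = yᶜ / (σ_{m+1} |y|^{m+1})`, with `y = ∑ s, y_s v_s`. -/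
noncomputable def cauchyKernel [StarRing A] (v : Fin (m + 1) → A)
    (y : EuclideanSpace ℝ (Fin (m + 1))) : A :=
  (1 / (sphereArea m * ‖y‖ ^ (m + 1))) • star (∑ s, y s • v s)

/-- The integral over `M ≅ ℝ^{m+1}` of an `A`-valued function, taken componentwise. -/
noncomputable def integralA (b : Module.Basis (Fin (d + 1)) ℝ A)
    (F : EuclideanSpace ℝ (Fin (m + 1)) → A) : A :=
  ∑ t, (∫ y, b.repr (F y) t) • b t

/-- `x ↦ ∫_M E(y) g(x_1, …, x_{i-1}, y + x_i, x_{i+1}, …, x_n) dy`. -/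
noncomputable def cauchyTransform [StarRing A] (b : Module.Basis (Fin (d + 1)) ℝ A)
    (v : Fin (m + 1) → A) (i : Fin n) (g : HyperSpace n m → A) (x : HyperSpace n m) : A :=
  integralA b (fun y => cauchyKernel v y * g (Function.update x i (y + x i)))

/-- `f` is a solution in `C_0^k(Mⁿ, A)` of the system `∂̄_j f = g_j`, `j = 1, …, n`. -/
def IsCompactSolution (b : Module.Basis (Fin (d + 1)) ℝ A) (v : Fin (m + 1) → A) (k : ℕ∞)
    (g : Fin n → HyperSpace n m → A) (f : HyperSpace n m → A) : Prop :=
  IsCkCompact b k f ∧ ∀ j x, dirac b v j f x = g j x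

/-- `f` vanishes on the unbounded component of the complement of `⋃ j, supp g_j`. -/
def VanishesOnUnboundedComponent (g : Fin n → HyperSpace n m → A) (f : HyperSpace n m → A) : Prop :=
  ∀ x ∈ (⋃ j, tsupport (g j))ᶜ,
    ¬ Bornology.IsBounded (connectedComponentIn (⋃ j, tsupport (g j))ᶜ x) → f x = 0

end Functions

/-!
Only the real-linear operators `L_s`, left multiplication by `v_s`, and `L'_s`, left multiplication
by `v_sᶜ`, matter. The linearised left alternative law and the relations of a hypercomplex basis
give `L'_r L_s + L'_s L_r = 2 δ_{rs} = L_r L'_s + L_s L'_r` (`IsHypercomplexBasis.isCliffordPair`),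
so that `A ≅ ℝ^{d+1}` is a Clifford module and the lack of associativity plays no further role.

The components `e_s(y) = y_s / (σ_{m+1} |y|^{m+1})` of the Cauchy kernel are locally integrable, and
in the sense of distributions their divergence is the Dirac measure
(`sum_integral_cauchyComponent_smul_fderiv`) and their curl vanishes
(`integral_cauchyComponent_smul_fderiv_comm`). With the Clifford relations this yields, for the
transform `T_i F (x) = ∫ E(y) F(x + ι_i y) dy`, both `T_i ∂̄_i F = -F` (`cauchyOp_diracOp`) and
`∂̄_i T_i F = -F` (`diracOp_cauchyOp`) on functions with compact support; `T_i` commutes with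
derivatives. In particular a function annihilated by `∂̄_j`, or by `∂_j`, vanishes on every slice in
the `j`-th variable on which it has compact support (`eq_zero_of_diracOp_eq_zero`).

* A solution `f` of the system satisfies
  `∂̄_i ∂_j g_j = ∂̄_i ∂_j ∂̄_j f = ∂̄_i Δ_j f = Δ_j ∂̄_i f = Δ_j g_i`.
* If these compatibility conditions hold, put `f = -T_1 g_1`. For `j ≠ 1`,
  `∂_j (∂̄_j f - g_j) = Δ_j f - ∂_j g_j = -T_1 Δ_j g_1 - ∂_j g_j = -T_1 ∂̄_1 ∂_j g_j - ∂_j g_j = 0`,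
  and `∂̄_j f - g_j` has compact slices in the `j`-th variable, hence vanishes. This is the integral
  condition (`diracOp_neg_cauchyOp_of_compatible`).
* If the integral condition holds, `f = -T_1 g_1` solves the system. It vanishes where one of
  `x_2, …, x_n` is large; where `x_1` is large it is annihilated by `∂̄_2` and has compact slices in
  `x_2`, so that it vanishes there too (`hasCompactSupport_of_eq_neg_cauchyOp`).

A solution `f` is annihilated by all `∂̄_j` off the supports of the `g_j`, and vanishes near some
point of the unbounded component, so that unique continuation is what remains. In one variable,
`u = -T ∂̄ u` represents `u` as a potential of a density that vanishes on a ball where `∂̄ u = 0`;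
along a segment in that ball the potential extends to a holomorphic function
(`exists_holomorphic_extension_potential`), and the identity theorem applies. In several variables
one proceeds in boxes, one variable at a time (`eq_zero_on_box`).
-/

/-! ### The kernel and its local integrability -/

/-- The `s`-th component `y_s / (σ_{m+1} |y|^{m+1})` of the Cauchy kernel. At `y = 0` it is `0`. -/
noncomputable def cauchyComponent (m : ℕ) (s : Fin (m + 1)) (y : EuclideanSpace ℝ (Fin (m + 1))) :
    ℝ :=
  1 / (sphereArea m * ‖y‖ ^ (m + 1)) * y s

lemma sphereArea_pos (m : ℕ) : 0 < sphereArea m := by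
  unfold sphereArea
  have h1 : 0 < Real.Gamma (1 / 2) := Real.Gamma_pos_of_pos (by norm_num)
  have h2 : 0 < Real.Gamma (((m : ℝ) + 1) / 2) := Real.Gamma_pos_of_pos (by positivity)
  positivity

lemma sphereArea_eq_toSphere (m : ℕ) :
    sphereArea m =
      (volume : Measure (EuclideanSpace ℝ (Fin (m + 1)))).toSphere.real Set.univ := by
  have h2 : Real.Gamma (((m : ℝ) + 1) / 2) ≠ 0 :=
    (Real.Gamma_pos_of_pos (by positivity)).ne'
  have h3 : Real.Gamma (((m + 1 : ℕ) : ℝ) / 2 + 1) =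
      (((m : ℝ) + 1) / 2) * Real.Gamma (((m : ℝ) + 1) / 2) := by
    push_cast
    exact Real.Gamma_add_one (by positivity)
  rw [Measure.toSphere_real_apply_univ, measureReal_def, EuclideanSpace.volume_ball, sphereArea,
    Real.Gamma_one_half_eq, Fintype.card_fin, h3, finrank_euclideanSpace_fin]
  have hp : 0 ≤ Real.sqrt Real.pi ^ (m + 1) /
      (((m : ℝ) + 1) / 2 * Real.Gamma (((m : ℝ) + 1) / 2)) := by
    have : 0 < Real.Gamma (((m : ℝ) + 1) / 2) := Real.Gamma_pos_of_pos (by positivity)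
    positivity
  simp only [ENNReal.ofReal_one, one_pow, one_mul, ENNReal.toReal_ofReal hp]
  push_cast
  field_simp

lemma integrableOn_inv_norm_pow (m : ℕ) (R : ℝ) :
    IntegrableOn (fun y : EuclideanSpace ℝ (Fin (m + 1)) => (‖y‖ ^ m)⁻¹) (Metric.ball 0 R) := by
  rw [integrableOn_fun_norm_addHaar volume (f := fun r => (r ^ m)⁻¹)]
  simp only [finrank_euclideanSpace_fin, Nat.add_sub_cancel, smul_eq_mul]
  refine (integrableOn_const (C := (1 : ℝ)) (by simp) (by simp)).congr_fun ?_ measurableSet_Ioo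
  intro r hr
  have : r ^ m ≠ 0 := pow_ne_zero _ hr.1.ne'
  simp [this]

lemma abs_cauchyComponent_le (m : ℕ) (s : Fin (m + 1)) (y : EuclideanSpace ℝ (Fin (m + 1))) :
    |cauchyComponent m s y| ≤ (sphereArea m)⁻¹ * (‖y‖ ^ m)⁻¹ := by
  have hσ := sphereArea_pos m
  rcases eq_or_ne y 0 with rfl | hy
  · simp only [cauchyComponent, PiLp.zero_apply, mul_zero, abs_zero]
    positivity
  have hy' : 0 < ‖y‖ := norm_pos_iff.2 hy
  have h : |y s| ≤ ‖y‖ := PiLp.norm_apply_le y s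
  rw [cauchyComponent, abs_mul, abs_of_pos (by positivity)]
  calc 1 / (sphereArea m * ‖y‖ ^ (m + 1)) * |y s|
      ≤ 1 / (sphereArea m * ‖y‖ ^ (m + 1)) * ‖y‖ := by gcongr
    _ = _ := by rw [pow_succ]; field_simp

lemma measurable_cauchyComponent (m : ℕ) (s : Fin (m + 1)) :
    Measurable (cauchyComponent m s) := by
  unfold cauchyComponent
  fun_prop

lemma locallyIntegrable_cauchyComponent (m : ℕ) (s : Fin (m + 1)) :
    LocallyIntegrable (cauchyComponent m s) := by
  rw [locallyIntegrable_iff]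
  intro K hK
  obtain ⟨R, hR⟩ := hK.isBounded.subset_ball 0
  refine IntegrableOn.mono_set ?_ hR
  refine Integrable.mono' ((integrableOn_inv_norm_pow m R).const_mul (sphereArea m)⁻¹)
    (measurable_cauchyComponent m s).aestronglyMeasurable ?_
  exact .of_forall fun y => abs_cauchyComponent_le m s y

section Moments

variable {V : Type*} [NormedAddCommGroup V] [NormedSpace ℝ V]

/-- In polar coordinates `y = r ω` the integrand is the radial derivative `∂/∂r u(r ω)`, whose
integral over each ray is `-u(0)`. -/
lemma integral_inv_norm_pow_smul_fderiv_self {E : Type*} [NormedAddCommGroup E] [NormedSpace ℝ E]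
    [MeasurableSpace E] [BorelSpace E] [FiniteDimensional ℝ E] [Nontrivial E] [CompleteSpace V]
    (μ : Measure E) [μ.IsAddHaarMeasure] {u : E → V} (hu : ContDiff ℝ 1 u)
    (hc : HasCompactSupport u)
    (hint : Integrable
      (fun y => (‖y‖ ^ Module.finrank ℝ E)⁻¹ • fderiv ℝ u y y) μ) :
    ∫ y, (‖y‖ ^ Module.finrank ℝ E)⁻¹ • fderiv ℝ u y y ∂μ =
      -(μ.toSphere.real Set.univ • u 0) := by
  set N := Module.finrank ℝ E with hN
  have hNpos : 0 < N := Module.finrank_pos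
  set F : E → V := fun y => (‖y‖ ^ N)⁻¹ • fderiv ℝ u y y with hF
  have mp := μ.measurePreserving_homeomorphUnitSphereProd
  have emb := (homeomorphUnitSphereProd E).measurableEmbedding
  let G : Metric.sphere (0 : E) 1 × Set.Ioi (0 : ℝ) → V :=
    fun p => F ((homeomorphUnitSphereProd E).symm p)
  have hcomp : (fun x : ({0}ᶜ : Set E) => G (homeomorphUnitSphereProd E x)) =
      fun x : ({0}ᶜ : Set E) => F (x : E) := by
    funext x
    simp only [G, Homeomorph.symm_apply_apply]
  have e1 : ∫ y, F y ∂μ = ∫ x : ({0}ᶜ : Set E), F x ∂(μ.comap (↑)) := by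
    rw [integral_subtype_comap (measurableSet_singleton _).compl F,
        restrict_compl_singleton]
  have hGint : Integrable G (μ.toSphere.prod (Measure.volumeIoiPow (N - 1))) := by
    rw [← mp.integrable_comp_emb emb]
    have h2 : Integrable (fun x : ({0}ᶜ : Set E) => F x) (μ.comap (↑)) := by
      have := integrableOn_iff_comap_subtypeVal (μ := μ) (f := F)
        (measurableSet_singleton (0 : E)).compl
      exact this.1 hint.integrableOn
    rw [← hcomp] at h2
    exact h2
  have e2 : ∫ x : ({0}ᶜ : Set E), F x ∂(μ.comap (↑)) =
      ∫ p, G p ∂(μ.toSphere.prod (Measure.volumeIoiPow (N - 1))) := by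
    rw [← mp.integral_comp emb G, hcomp]
  rw [e1, e2, integral_prod _ hGint]
  have inner : ∀ ω : Metric.sphere (0 : E) 1,
      ∫ r, G (ω, r) ∂(Measure.volumeIoiPow (N - 1)) = - u 0 := by
    intro ω
    have hω : ‖(ω : E)‖ = 1 := by simp
    have hd : ∀ r : ℝ, HasDerivAt (fun r : ℝ => u (r • (ω : E)))
        (fderiv ℝ u (r • (ω : E)) ω) r := by
      intro r
      have h1 : HasFDerivAt u (fderiv ℝ u (r • (ω : E))) (r • (ω : E)) :=
        (hu.differentiable one_ne_zero _).hasFDerivAt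
      have h2 : HasDerivAt (fun r : ℝ => r • (ω : E)) ((1 : ℝ) • (ω : E)) r :=
        (hasDerivAt_id r).smul_const _
      have h3 := h1.comp_hasDerivAt r h2
      rw [one_smul] at h3
      exact h3
    have hcs : HasCompactSupport (fun r : ℝ => u (r • (ω : E))) := by
      obtain ⟨R, hR⟩ := hc.isCompact.isBounded.subset_closedBall 0
      refine HasCompactSupport.of_support_subset_isCompact (isCompact_closedBall (0 : ℝ) R) ?_
      intro r hr
      have := hR (subset_tsupport _ hr)
      simpa [norm_smul, hω] using this
    have hcd : ContDiff ℝ 1 (fun r : ℝ => u (r • (ω : E))) :=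
      hu.comp (contDiff_id.smul contDiff_const)
    -- the factor `r ^ (N - 1)` of the polar density cancels against the kernel, leaving the radial
    -- derivative of `u`
    have key := hcs.integral_Ioi_deriv_eq hcd 0
    rw [zero_smul] at key
    rw [← key]
    simp only [Measure.volumeIoiPow, ENNReal.ofReal]
    rw [integral_withDensity_eq_integral_smul
      ((measurable_subtype_coe.pow_const _).real_toNNReal)]
    change ∫ r : Set.Ioi (0 : ℝ), Real.toNNReal ((r : ℝ) ^ (N - 1)) • F ((r : ℝ) • (ω : E))
      ∂(Measure.comap Subtype.val volume) = _
    rw [      integral_subtype_comap measurableSet_Ioi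
        fun a : ℝ ↦ Real.toNNReal (a ^ (N - 1)) • F (a • (ω : E))]
    refine setIntegral_congr_fun measurableSet_Ioi fun r (hr : 0 < r) => ?_
    simp only [(hd r).deriv]
    rw [NNReal.smul_def, Real.coe_toNNReal _ (pow_nonneg hr.le _), hF]
    simp only [norm_smul, hω, mul_one, Real.norm_of_nonneg hr.le, map_smul, smul_smul]
    have : r ^ (N - 1) * ((r ^ N)⁻¹ * r) = 1 := by
      have : r ^ N = r ^ (N - 1) * r := by rw [← pow_succ, Nat.sub_add_cancel hNpos]
      rw [this]
      field_simp
    rw [← mul_assoc] at this ⊢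
    rw [this, one_smul]
  simp [inner]


/-- Integration by parts against the components of a smooth radial vector field `c(|y|²) y`, whose
curl vanishes. -/
lemma integral_radial_curl_free {m : ℕ} {c c' : ℝ → ℝ}
    (hcd : ∀ t, 0 ≤ t → HasDerivAt c (c' t) t) (hcc : ContinuousOn c' (Set.Ici 0))
    {u : EuclideanSpace ℝ (Fin (m + 1)) → V} (hu : ContDiff ℝ 1 u) (hc : HasCompactSupport u)
    {r s : Fin (m + 1)} (hrs : r ≠ s) :
    ∫ y, (c (‖y‖ ^ 2) * y r) • fderiv ℝ u y (EuclideanSpace.single s 1) =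
      -∫ y, (2 * c' (‖y‖ ^ 2) * y s * y r) • u y := by
  have hder : ∀ y : EuclideanSpace ℝ (Fin (m + 1)),
      HasFDerivAt (fun y : EuclideanSpace ℝ (Fin (m + 1)) => c (‖y‖ ^ 2) * y r)
        (c (‖y‖ ^ 2) • (EuclideanSpace.proj r : _ →L[ℝ] ℝ) +
          y r • (c' (‖y‖ ^ 2) • (2 • innerSL ℝ y))) y := by
    intro y
    have h1 : HasFDerivAt (fun y : EuclideanSpace ℝ (Fin (m + 1)) => c (‖y‖ ^ 2))
        (c' (‖y‖ ^ 2) • (2 • innerSL ℝ y)) y :=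
      (hcd _ (by positivity)).comp_hasFDerivAt y (hasStrictFDerivAt_norm_sq y).hasFDerivAt
    have h2 : HasFDerivAt (fun y : EuclideanSpace ℝ (Fin (m + 1)) => y r)
        (EuclideanSpace.proj r : _ →L[ℝ] ℝ) y :=
      (EuclideanSpace.proj r : EuclideanSpace ℝ (Fin (m + 1)) →L[ℝ] ℝ).hasFDerivAt
    exact h1.mul h2
  have hval : ∀ y : EuclideanSpace ℝ (Fin (m + 1)),
      fderiv ℝ (fun y : EuclideanSpace ℝ (Fin (m + 1)) => c (‖y‖ ^ 2) * y r) y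
        (EuclideanSpace.single s 1) = 2 * c' (‖y‖ ^ 2) * y s * y r := by
    intro y
    rw [(hder y).fderiv]
    simp [hrs, EuclideanSpace.inner_single_right]
    ring
  have hcont : Continuous (fun y : EuclideanSpace ℝ (Fin (m + 1)) => c (‖y‖ ^ 2) * y r) :=
    continuous_iff_continuousAt.2 fun y => (hder y).continuousAt
  have hcont' : Continuous
      (fun y : EuclideanSpace ℝ (Fin (m + 1)) => 2 * c' (‖y‖ ^ 2) * y s * y r) := by
    have : Continuous (fun y : EuclideanSpace ℝ (Fin (m + 1)) => c' (‖y‖ ^ 2)) :=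
      hcc.comp_continuous (by fun_prop) fun y => by simp
    exact ((continuous_const.mul this).mul (by fun_prop)).mul (by fun_prop)
  have hfd : Continuous (fun y => fderiv ℝ u y (EuclideanSpace.single s 1)) :=
    (hu.continuous_fderiv one_ne_zero).clm_apply continuous_const
  have hfc : HasCompactSupport (fun y => fderiv ℝ u y (EuclideanSpace.single s 1)) :=
    hc.fderiv_apply ℝ _
  have := integral_smul_fderiv_eq_neg_fderiv_smul_of_integrable (μ := volume)
    (f := fun y : EuclideanSpace ℝ (Fin (m + 1)) => c (‖y‖ ^ 2) * y r) (g := u)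
    (v := EuclideanSpace.single s 1)
    (by
      simp only [hval]
      exact (hcont'.smul hu.continuous).integrable_of_hasCompactSupport hc.smul_left)
    ((hcont.smul hfd).integrable_of_hasCompactSupport hfc.smul_left)
    ((hcont.smul hu.continuous).integrable_of_hasCompactSupport hc.smul_left)
    (fun y _ => (hder y).differentiableAt) (fun y _ => hu.differentiable one_ne_zero y)
  simpa only [hval] using this

/-- The Cauchy kernel is curl-free as a distribution: it is the limit of the smooth radial fields
`(ε + |y|²)^{-(m+1)/2} y / σ_{m+1}`. -/
lemma integral_cauchyComponent_smul_fderiv_comm {m : ℕ}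
    {u : EuclideanSpace ℝ (Fin (m + 1)) → V} (hu : ContDiff ℝ 1 u) (hc : HasCompactSupport u)
    (r s : Fin (m + 1)) :
    ∫ y, cauchyComponent m r y • fderiv ℝ u y (EuclideanSpace.single s 1) =
      ∫ y, cauchyComponent m s y • fderiv ℝ u y (EuclideanSpace.single r 1) := by
  rcases eq_or_ne r s with rfl | hrs
  · rfl
  set p : ℝ := -(((m + 1 : ℕ) : ℝ) / 2) with hp
  let ε : ℕ → ℝ := fun k => 1 / ((k : ℝ) + 1)
  have hε : ∀ k, 0 < ε k := fun k => by positivity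
  have hε0 : Filter.Tendsto ε Filter.atTop (nhds 0) := tendsto_one_div_add_atTop_nhds_zero_nat
  have hσ := sphereArea_pos m
  -- the value of the regularised kernel at `ε = 0`
  have hpow : ∀ y : EuclideanSpace ℝ (Fin (m + 1)), y ≠ 0 →
      (‖y‖ ^ 2) ^ p = (‖y‖ ^ (m + 1))⁻¹ := by
    intro y hy
    rw [← Real.rpow_natCast, ← Real.rpow_natCast ‖y‖ (m + 1), ← Real.rpow_neg (norm_nonneg _),
      ← Real.rpow_mul (norm_nonneg _), hp]
    congr 1
    push_cast
    ring
  have lim : ∀ a b : Fin (m + 1), Filter.Tendsto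
      (fun k => ∫ y, ((ε k + ‖y‖ ^ 2) ^ p * y a) • fderiv ℝ u y (EuclideanSpace.single b 1))
      Filter.atTop (nhds (∫ y, (sphereArea m * cauchyComponent m a y) •
        fderiv ℝ u y (EuclideanSpace.single b 1))) := by
    intro a b
    have hfd : Continuous (fun y => fderiv ℝ u y (EuclideanSpace.single b 1)) :=
      (hu.continuous_fderiv one_ne_zero).clm_apply continuous_const
    have hfc : HasCompactSupport (fun y => fderiv ℝ u y (EuclideanSpace.single b 1)) :=
      hc.fderiv_apply ℝ _
    have hint : Integrable (fun y => sphereArea m • cauchyComponent m a y •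
        fderiv ℝ u y (EuclideanSpace.single b 1)) := ((locallyIntegrable_cauchyComponent m
      a).integrable_smul_right_of_hasCompactSupport hfd hfc).smul (sphereArea m)
    refine tendsto_integral_of_dominated_convergence
      (fun y => ‖sphereArea m • cauchyComponent m a y •
        fderiv ℝ u y (EuclideanSpace.single b 1)‖) ?_ hint.norm ?_ ?_
    · intro k
      refine Continuous.aestronglyMeasurable (Continuous.smul (Continuous.mul ?_ (by fun_prop)) hfd)
      exact Continuous.rpow_const (by fun_prop) fun y => Or.inl (by have := hε k; positivity)
    · intro k
      refine .of_forall fun y => ?_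
      rcases eq_or_ne y 0 with rfl | hy
      · simp
      rw [smul_smul, norm_smul, norm_smul]
      gcongr
      have hy' : 0 < ‖y‖ := norm_pos_iff.2 hy
      rw [cauchyComponent, norm_mul, norm_mul, norm_mul, ← mul_assoc]
      gcongr
      rw [Real.norm_of_nonneg (by have := hε k; positivity), Real.norm_of_nonneg hσ.le,
        Real.norm_of_nonneg (by positivity)]
      calc (ε k + ‖y‖ ^ 2) ^ p ≤ (‖y‖ ^ 2) ^ p :=
            Real.rpow_le_rpow_of_nonpos (by positivity) (by linarith [hε k])
              (by rw [hp]; exact neg_nonpos.2 (by positivity))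
        _ = (‖y‖ ^ (m + 1))⁻¹ := hpow y hy
        _ = _ := by field_simp
    · refine .of_forall fun y => ?_
      rcases eq_or_ne y 0 with rfl | hy
      · simp [cauchyComponent]
      have hy' : 0 < ‖y‖ := norm_pos_iff.2 hy
      have e : sphereArea m * cauchyComponent m a y = (0 + ‖y‖ ^ 2) ^ p * y a := by
        rw [zero_add, hpow y hy, cauchyComponent]
        field_simp
      rw [e]
      refine Filter.Tendsto.smul_const (Filter.Tendsto.mul_const _ ?_) _
      exact (hε0.add_const _).rpow_const (Or.inl (by positivity))
  have eq : ∀ k, ∫ y, ((ε k + ‖y‖ ^ 2) ^ p * y r) • fderiv ℝ u y (EuclideanSpace.single s 1) =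
      ∫ y, ((ε k + ‖y‖ ^ 2) ^ p * y s) • fderiv ℝ u y (EuclideanSpace.single r 1) := by
    intro k
    have hd : ∀ t, 0 ≤ t → HasDerivAt (fun t => (ε k + t) ^ p) (p * (ε k + t) ^ (p - 1)) t := by
      intro t ht
      have h1 : HasDerivAt (fun t => ε k + t) 1 t := (hasDerivAt_id t).const_add _
      have := h1.rpow_const (p := p) (Or.inl (by have := hε k; positivity))
      simpa [mul_comm] using this
    have hcc : ContinuousOn (fun t => p * (ε k + t) ^ (p - 1)) (Set.Ici 0) := by
      refine continuousOn_const.mul (ContinuousOn.rpow_const (by fun_prop) fun t ht => Or.inl ?_)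
      have := hε k
      have : (0 : ℝ) ≤ t := ht
      positivity
    rw [integral_radial_curl_free hd hcc hu hc hrs, integral_radial_curl_free hd hcc hu hc hrs.symm]
    congr 2 with y
    congr 1
    ring
  have h := tendsto_nhds_unique ((lim r s).congr eq) (lim s r)
  simp only [← smul_smul, integral_smul] at h
  exact smul_right_injective _ hσ.ne' h

/-- The divergence of the Cauchy kernel is the Dirac measure at the origin. -/
lemma sum_integral_cauchyComponent_smul_fderiv [CompleteSpace V] {m : ℕ}
    {u : EuclideanSpace ℝ (Fin (m + 1)) → V} (hu : ContDiff ℝ 1 u) (hc : HasCompactSupport u) :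
    ∑ s, ∫ y, cauchyComponent m s y • fderiv ℝ u y (EuclideanSpace.single s 1) = - u 0 := by
  have hσ := sphereArea_pos m
  have hint : ∀ s, Integrable (fun y => cauchyComponent m s y •
      fderiv ℝ u y (EuclideanSpace.single s 1)) := fun s =>
    (locallyIntegrable_cauchyComponent m s).integrable_smul_right_of_hasCompactSupport
      ((hu.continuous_fderiv one_ne_zero).clm_apply continuous_const) (hc.fderiv_apply ℝ _)
  rw [← integral_finsetSum _ fun s _ => hint s]
  have hpt : ∀ y : EuclideanSpace ℝ (Fin (m + 1)),
      ∑ s, cauchyComponent m s y • fderiv ℝ u y (EuclideanSpace.single s 1) =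
        (sphereArea m)⁻¹ •
          ((‖y‖ ^ Module.finrank ℝ (EuclideanSpace ℝ (Fin (m + 1))))⁻¹ • fderiv ℝ u y y) := by
    intro y
    have hy : y = ∑ s, y s • EuclideanSpace.single s (1 : ℝ) := by
      ext t
      simp [Finset.sum_apply, Pi.single_apply]
    rw [finrank_euclideanSpace_fin]
    conv_rhs => rw [smul_smul]; arg 2; arg 2; rw [hy]
    rw [map_sum, Finset.smul_sum]
    refine Finset.sum_congr rfl fun s _ => ?_
    rw [map_smul, smul_smul, cauchyComponent, one_div, mul_inv]
  have hint' := integrable_finsetSum Finset.univ fun s _ => hint s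
  simp only [hpt] at hint' ⊢
  have hint'' := (integrable_smul_iff (inv_ne_zero hσ.ne') _).1 hint'
  rw [integral_smul, integral_inv_norm_pow_smul_fderiv_self volume hu hc hint'',
    ← sphereArea_eq_toSphere, smul_neg, inv_smul_smul₀ hσ.ne']

end Moments

universe u

/-! ### Integral transforms along a subspace of the variables -/

lemma HasCompactSupport.comp_add_clm {W X V : Type*} [NormedAddCommGroup W] [NormedSpace ℝ W]
    [FiniteDimensional ℝ W] [NormedAddCommGroup X] [NormedSpace ℝ X] [Zero V]
    {ι : W →L[ℝ] X} {F : X → V} (hι : ∀ y, ‖y‖ ≤ ‖ι y‖) (hc : HasCompactSupport F) (x : X) :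
    HasCompactSupport (fun y => F (x + ι y)) := by
  obtain ⟨R, hR⟩ := hc.isCompact.isBounded.subset_closedBall 0
  refine HasCompactSupport.of_support_subset_isCompact (isCompact_closedBall (0 : W) (R + ‖x‖)) ?_
  intro y hy
  have h1 : ‖x + ι y‖ ≤ R := by simpa using hR (subset_tsupport _ hy)
  have h2 : ‖ι y‖ ≤ ‖x + ι y‖ + ‖x‖ := by
    simpa using norm_sub_le (x + ι y) x
  have := hι y
  simp only [Metric.mem_closedBall, dist_zero_right]
  linarith

section Transform

variable {W X : Type*} [NormedAddCommGroup W] [NormedSpace ℝ W] [MeasurableSpace W]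
  [BorelSpace W] [FiniteDimensional ℝ W] [NormedAddCommGroup X] [NormedSpace ℝ X]

/-- The transform `x ↦ ∫ e(y) F(x + ι y) dy` of `F` by a real kernel `e` along the range of the
linear map `ι`. -/
noncomputable def kernelTransform {V : Type*} [NormedAddCommGroup V] [NormedSpace ℝ V]
    (μ : Measure W) (e : W → ℝ) (ι : W →L[ℝ] X) (F : X → V) (x : X) : V :=
  ∫ y, e y • F (x + ι y) ∂μ

variable {V V' : Type*} [NormedAddCommGroup V] [NormedSpace ℝ V] [NormedAddCommGroup V']
  [NormedSpace ℝ V'] {μ : Measure W} {e : W → ℝ} {ι : W →L[ℝ] X} {F : X → V}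

/-- Only a fixed ball of values of `y` contributes to the transform near a given point `x`. -/
lemma apply_add_eq_zero_of_notMem_closedBall {W X V : Type*} [NormedAddCommGroup W]
    [NormedSpace ℝ W] [NormedAddCommGroup X] [NormedSpace ℝ X] [Zero V] {ι : W →L[ℝ] X} {F : X → V}
    (hι : ∀ y, ‖y‖ ≤ ‖ι y‖) {R : ℝ} (hR : tsupport F ⊆ Metric.closedBall 0 R) {x x' : X}
    (hx' : x' ∈ Metric.ball x 1) {y : W} (hy : y ∉ Metric.closedBall (0 : W) (R + ‖x‖ + 1)) :
    F (x' + ι y) = 0 := by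
  by_contra h
  apply hy
  have h1 : ‖x' + ι y‖ ≤ R := by simpa using hR (subset_tsupport _ h)
  have h2 : ‖ι y‖ ≤ ‖x' + ι y‖ + ‖x'‖ := by
    simpa using norm_sub_le (x' + ι y) x'
  have h3 : ‖x'‖ ≤ ‖x‖ + 1 := by
    have := norm_sub_norm_le x' x
    rw [mem_ball_iff_norm] at hx'
    linarith
  have := hι y
  simp only [Metric.mem_closedBall, dist_zero_right]
  linarith

lemma integrable_kernelTransform (he : LocallyIntegrable e μ) (hι : ∀ y, ‖y‖ ≤ ‖ι y‖)
    (hF : Continuous F) (hc : HasCompactSupport F) (x : X) :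
    Integrable (fun y => e y • F (x + ι y)) μ :=
  he.integrable_smul_right_of_hasCompactSupport (by fun_prop) (hc.comp_add_clm hι x)

lemma kernelTransform_clm_comp [CompleteSpace V] [CompleteSpace V'] (Λ : V →L[ℝ] V')
    (he : LocallyIntegrable e μ) (hι : ∀ y, ‖y‖ ≤ ‖ι y‖)
    (hF : Continuous F) (hc : HasCompactSupport F) (x : X) :
    kernelTransform μ e ι (fun x => Λ (F x)) x = Λ (kernelTransform μ e ι F x) := by
  unfold kernelTransform
  rw [← Λ.integral_comp_comm (integrable_kernelTransform he hι hF hc x)]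
  simp only [map_smul]

lemma hasFDerivAt_kernelTransform (he : LocallyIntegrable e μ) (hι : ∀ y, ‖y‖ ≤ ‖ι y‖)
    (hF : ContDiff ℝ 1 F) (hc : HasCompactSupport F) (x : X) :
    HasFDerivAt (kernelTransform μ e ι F) (kernelTransform μ e ι (fderiv ℝ F) x) x := by
  obtain ⟨R, hR⟩ := hc.isCompact.isBounded.subset_closedBall 0
  have hF' : Continuous (fderiv ℝ F) := hF.continuous_fderiv one_ne_zero
  have hc' : HasCompactSupport (fderiv ℝ F) := hc.fderiv ℝ
  obtain ⟨C, hC⟩ := hc'.exists_bound_of_continuous hF'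
  set K : Set W := Metric.closedBall 0 (R + ‖x‖ + 1)
  have hKm : MeasurableSet K := measurableSet_closedBall
  unfold kernelTransform
  refine hasFDerivAt_integral_of_dominated_of_fderiv_le
    (F' := fun x y => e y • fderiv ℝ F (x + ι y))
    (bound := K.indicator fun y => ‖e y‖ * C)
    (Metric.ball_mem_nhds x one_pos) ?_ ?_ ?_ ?_ ?_ ?_
  · exact .of_forall fun x' =>
      (integrable_kernelTransform he hι hF.continuous hc x').aestronglyMeasurable
  · exact integrable_kernelTransform he hι hF.continuous hc x
  · exact (integrable_kernelTransform he hι hF' hc' x).aestronglyMeasurable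
  · refine .of_forall fun y x' hx' => ?_
    by_cases hy : y ∈ K
    · rw [Set.indicator_of_mem hy, norm_smul]
      gcongr
      exact hC _
    · rw [Set.indicator_of_notMem hy]
      have h0 : fderiv ℝ F (x' + ι y) = 0 :=
        apply_add_eq_zero_of_notMem_closedBall hι ((tsupport_fderiv_subset ℝ).trans hR) hx' hy
      simp [h0]
  · rw [integrable_indicator_iff hKm]
    exact ((he.integrableOn_isCompact (isCompact_closedBall _ _)).norm).mul_const C
  · refine .of_forall fun y x' _ => ?_
    have h1 : HasFDerivAt F (fderiv ℝ F (x' + ι y)) (x' + ι y) :=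
      (hF.differentiable one_ne_zero _).hasFDerivAt
    exact ((hasFDerivAt_comp_add_right (ι y)).2 h1).const_smul (e y)

lemma fderiv_kernelTransform (he : LocallyIntegrable e μ) (hι : ∀ y, ‖y‖ ≤ ‖ι y‖)
    (hF : ContDiff ℝ 1 F) (hc : HasCompactSupport F) :
    fderiv ℝ (kernelTransform μ e ι F) = kernelTransform μ e ι (fderiv ℝ F) :=
  funext fun x => (hasFDerivAt_kernelTransform he hι hF hc x).fderiv

lemma fderiv_kernelTransform_apply [CompleteSpace V] (he : LocallyIntegrable e μ)
    (hι : ∀ y, ‖y‖ ≤ ‖ι y‖) (hF : ContDiff ℝ 1 F) (hc : HasCompactSupport F) (x w : X) :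
    fderiv ℝ (kernelTransform μ e ι F) x w =
      kernelTransform μ e ι (fun x => fderiv ℝ F x w) x := by
  rw [fderiv_kernelTransform he hι hF hc]
  exact (kernelTransform_clm_comp (ContinuousLinearMap.apply ℝ V w) he hι
    (hF.continuous_fderiv one_ne_zero) (hc.fderiv ℝ) x).symm

end Transform

/-- The spaces `X` and `V` share a universe because the induction on `k` replaces `V` by
`X →L[ℝ] V`. -/
lemma contDiff_nat_kernelTransform {W : Type*} {X : Type u} [NormedAddCommGroup W]
    [NormedSpace ℝ W] [MeasurableSpace W] [BorelSpace W] [FiniteDimensional ℝ W]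
    [NormedAddCommGroup X] [NormedSpace ℝ X] {μ : Measure W} {e : W → ℝ} {ι : W →L[ℝ] X}
    (he : LocallyIntegrable e μ) (hι : ∀ y, ‖y‖ ≤ ‖ι y‖) (k : ℕ) :
    ∀ {V : Type u} [NormedAddCommGroup V] [NormedSpace ℝ V] {F : X → V},
      ContDiff ℝ k F → HasCompactSupport F → ContDiff ℝ k (kernelTransform μ e ι F) := by
  induction k with
  | zero =>
    intro V _ _ F hF hc
    rw [Nat.cast_zero, contDiff_zero] at hF ⊢
    obtain ⟨R, hR⟩ := hc.isCompact.isBounded.subset_closedBall 0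
    obtain ⟨C, hC⟩ := hc.exists_bound_of_continuous hF
    refine continuous_iff_continuousAt.2 fun x => ?_
    set K : Set W := Metric.closedBall 0 (R + ‖x‖ + 1)
    refine continuousAt_of_dominated (bound := K.indicator fun y => ‖e y‖ * C) ?_ ?_ ?_ ?_
    · exact .of_forall fun x' =>
        (integrable_kernelTransform he hι hF hc x').aestronglyMeasurable
    · filter_upwards [Metric.ball_mem_nhds x one_pos] with x' hx'
      refine .of_forall fun y => ?_
      by_cases hy : y ∈ K
      · rw [Set.indicator_of_mem hy, norm_smul]
        gcongr
        exact hC _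
      · rw [Set.indicator_of_notMem hy, apply_add_eq_zero_of_notMem_closedBall hι hR hx' hy]
        simp
    · rw [integrable_indicator_iff measurableSet_closedBall]
      exact ((he.integrableOn_isCompact (isCompact_closedBall _ _)).norm).mul_const C
    · exact .of_forall fun y => by fun_prop
  | succ k ih =>
    intro V _ _ F hF hc
    have h1 : ContDiff ℝ 1 F := hF.of_le (by exact_mod_cast Nat.le_add_left 1 k)
    rw [Nat.cast_succ, contDiff_succ_iff_fderiv] at hF ⊢
    refine ⟨fun x => (hasFDerivAt_kernelTransform he hι h1 hc x).differentiableAt, by simp, ?_⟩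
    rw [fderiv_kernelTransform he hι h1 hc]
    exact ih hF.2.2 (hc.fderiv ℝ)

lemma contDiff_kernelTransform {W : Type*} {X V : Type u} [NormedAddCommGroup W]
    [NormedSpace ℝ W] [MeasurableSpace W] [BorelSpace W] [FiniteDimensional ℝ W]
    [NormedAddCommGroup X] [NormedSpace ℝ X] {μ : Measure W} {e : W → ℝ} {ι : W →L[ℝ] X}
    (he : LocallyIntegrable e μ) (hι : ∀ y, ‖y‖ ≤ ‖ι y‖) [NormedAddCommGroup V] [NormedSpace ℝ V]
    {F : X → V} {k : ℕ∞} (hF : ContDiff ℝ k F) (hc : HasCompactSupport F) :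
    ContDiff ℝ k (kernelTransform μ e ι F) := by
  rw [contDiff_iff_forall_nat_le] at hF ⊢
  exact fun j hj => contDiff_nat_kernelTransform he hι j (hF j hj) hc

/-! ### Directional derivatives -/

section DirDeriv

variable {X V V' : Type*} [NormedAddCommGroup X] [NormedSpace ℝ X] [NormedAddCommGroup V]
  [NormedSpace ℝ V] [NormedAddCommGroup V'] [NormedSpace ℝ V']

/-- The derivative of `F` in the direction `w`. -/
noncomputable def dirDeriv (w : X) (F : X → V) (x : X) : V := fderiv ℝ F x w

lemma ContDiff.dirDeriv {F : X → V} {k l : WithTop ℕ∞} (hF : ContDiff ℝ k F) (h : l + 1 ≤ k)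
    (w : X) : ContDiff ℝ l (dirDeriv w F) :=
  (hF.fderiv_right h).clm_apply contDiff_const

lemma HasCompactSupport.dirDeriv {F : X → V} (hc : HasCompactSupport F) (w : X) :
    HasCompactSupport (dirDeriv w F) :=
  hc.fderiv_apply ℝ w

lemma dirDeriv_clm_comp (Λ : V →L[ℝ] V') {F : X → V} (hF : Differentiable ℝ F) (w : X) :
    dirDeriv w (fun x => Λ (F x)) = fun x => Λ (dirDeriv w F x) := by
  funext x
  exact congrArg (fun T : X →L[ℝ] V' => T w) (Λ.hasFDerivAt.comp x (hF x).hasFDerivAt).fderiv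

lemma dirDeriv_finset_sum {κ : Type*} (S : Finset κ) {F : κ → X → V}
    (hF : ∀ i ∈ S, Differentiable ℝ (F i)) (w : X) :
    dirDeriv w (fun x => ∑ i ∈ S, F i x) = fun x => ∑ i ∈ S, dirDeriv w (F i) x := by
  funext x
  unfold dirDeriv
  rw [fderiv_fun_sum fun i hi => hF i hi x]
  simp

lemma dirDeriv_sum_clm {κ : Type*} [Fintype κ] (Λ : κ → V →L[ℝ] V') {F : κ → X → V}
    (hF : ∀ i, Differentiable ℝ (F i)) (w : X) :
    dirDeriv w (fun x => ∑ i, Λ i (F i x)) = fun x => ∑ i, Λ i (dirDeriv w (F i) x) := by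
  rw [dirDeriv_finset_sum _ fun i _ => (Λ i).differentiable.fun_comp (hF i)]
  funext x
  exact Finset.sum_congr rfl fun i _ => congrFun (dirDeriv_clm_comp (Λ i) (hF i) w) x

lemma dirDeriv_sub {F G : X → V} (hF : Differentiable ℝ F) (hG : Differentiable ℝ G) (w : X) :
    dirDeriv w (fun x => F x - G x) = fun x => dirDeriv w F x - dirDeriv w G x := by
  funext x
  unfold dirDeriv
  rw [fderiv_fun_sub (hF x) (hG x)]
  rfl

lemma dirDeriv_neg (F : X → V) (w : X) :
    dirDeriv w (fun x => -F x) = fun x => -dirDeriv w F x := by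
  funext x
  unfold dirDeriv
  rw [fderiv_fun_neg]
  rfl

lemma dirDeriv_comm {F : X → V} (hF : ContDiff ℝ 2 F) (w w' : X) :
    dirDeriv w (dirDeriv w' F) = dirDeriv w' (dirDeriv w F) := by
  funext x
  have hd : Differentiable ℝ (fderiv ℝ F) :=
    (hF.fderiv_right (m := 1) (by norm_num)).differentiable one_ne_zero
  have h : ∀ a b : X, dirDeriv a (dirDeriv b F) x = fderiv ℝ (fderiv ℝ F) x a b := by
    intro a b
    have := ((hd x).hasFDerivAt.clm_apply (hasFDerivAt_const b x)).fderiv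
    change fderiv ℝ (fun y => fderiv ℝ F y b) x a = _
    rw [this]
    simp
  rw [h, h]
  exact (hF.contDiffAt.isSymmSndFDerivAt (by simp)) w w'

end DirDeriv

/-! ### Dirac operators and the Cauchy transform in a Clifford module -/

section Dirac

/-- Two families of operators with `L'_r L_s + L'_s L_r = 2 δ_{rs}` and
`L_r L'_s + L_s L'_r = 2 δ_{rs}`, such as the left multiplications by `v_s` and `v_sᶜ`. -/
structure IsCliffordPair {κ V : Type*} [DecidableEq κ] [NormedAddCommGroup V] [NormedSpace ℝ V]
    (L L' : κ → V →L[ℝ] V) : Prop where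
  conj_mul : ∀ r s a, L' r (L s a) + L' s (L r a) = if r = s then (2 : ℝ) • a else 0
  mul_conj : ∀ r s a, L r (L' s a) + L s (L' r a) = if r = s then (2 : ℝ) • a else 0

variable {X V : Type*} [NormedAddCommGroup X] [NormedSpace ℝ X] [NormedAddCommGroup V]
  [NormedSpace ℝ V] {m : ℕ}

lemma IsCliffordPair.symm {κ : Type*} [DecidableEq κ] {L L' : κ → V →L[ℝ] V}
    (h : IsCliffordPair L L') : IsCliffordPair L' L :=
  ⟨h.mul_conj, h.conj_mul⟩

/-- Contracting a symmetric array against `L'_r L_s` leaves its trace. -/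
lemma IsCliffordPair.sum_sum_eq {κ : Type*} [DecidableEq κ] [Fintype κ] {L L' : κ → V →L[ℝ] V}
    (h : IsCliffordPair L L') {c : κ → κ → V} (hc : ∀ r s, c r s = c s r) :
    ∑ r, ∑ s, L' r (L s (c r s)) = ∑ r, c r r := by
  have h1 : ∑ r, ∑ s, L' r (L s (c r s)) = ∑ r, ∑ s, L' s (L r (c r s)) := by
    rw [Finset.sum_comm]
    refine Finset.sum_congr rfl fun r _ => Finset.sum_congr rfl fun s _ => ?_
    rw [hc]
  have h2 : (2 : ℝ) • ∑ r, ∑ s, L' r (L s (c r s)) = (2 : ℝ) • ∑ r, c r r := by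
    conv_lhs => rw [two_smul]; arg 2; rw [h1]
    simp only [← Finset.sum_add_distrib, h.conj_mul]
    simp [Finset.smul_sum]
  exact smul_right_injective _ (two_ne_zero) h2

/-- The Dirac operator `∑ s, L_s ∂_s` in the variable embedded in `X` by `ι`. -/
noncomputable def diracOp (L : Fin (m + 1) → V →L[ℝ] V)
    (ι : EuclideanSpace ℝ (Fin (m + 1)) →L[ℝ] X) (F : X → V) (x : X) : V :=
  ∑ s, L s (dirDeriv (ι (EuclideanSpace.single s 1)) F x)

/-- The Cauchy transform `x ↦ ∫ E(y) F(x + ι y) dy`, where `E(y) = ∑ s, e_s(y) L'_s`. -/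
noncomputable def cauchyOp (L' : Fin (m + 1) → V →L[ℝ] V)
    (ι : EuclideanSpace ℝ (Fin (m + 1)) →L[ℝ] X) (F : X → V) (x : X) : V :=
  ∑ s, L' s (kernelTransform volume (cauchyComponent m s) ι F x)

/-- The Laplacian in the variable embedded in `X` by `ι`. -/
noncomputable def laplacianOp (ι : EuclideanSpace ℝ (Fin (m + 1)) →L[ℝ] X) (F : X → V) (x : X) :
    V :=
  ∑ s, dirDeriv (ι (EuclideanSpace.single s 1)) (dirDeriv (ι (EuclideanSpace.single s 1)) F) x

variable {L L' : Fin (m + 1) → V →L[ℝ] V} {ι ι' : EuclideanSpace ℝ (Fin (m + 1)) →L[ℝ] X}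
  {F : X → V}

lemma ContDiff.diracOp {k l : WithTop ℕ∞} (hF : ContDiff ℝ k F) (h : l + 1 ≤ k)
    (L : Fin (m + 1) → V →L[ℝ] V) (ι : EuclideanSpace ℝ (Fin (m + 1)) →L[ℝ] X) :
    ContDiff ℝ l (diracOp L ι F) :=
  ContDiff.sum fun s _ => (L s).contDiff.comp (hF.dirDeriv h _)

lemma HasCompactSupport.diracOp (hc : HasCompactSupport F) (L : Fin (m + 1) → V →L[ℝ] V)
    (ι : EuclideanSpace ℝ (Fin (m + 1)) →L[ℝ] X) : HasCompactSupport (diracOp L ι F) := by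
  refine (hc.fderiv ℝ).mono' ?_
  intro x hx
  refine subset_tsupport _ fun h => hx ?_
  simp [_root_.diracOp, _root_.dirDeriv, h]

lemma diracOp_sub {G : X → V} (hF : Differentiable ℝ F) (hG : Differentiable ℝ G) (x : X) :
    diracOp L ι (fun x => F x - G x) x = diracOp L ι F x - diracOp L ι G x := by
  simp only [diracOp, dirDeriv_sub hF hG, map_sub, Finset.sum_sub_distrib]

lemma diracOp_neg (x : X) : diracOp L ι (fun x => -F x) x = -diracOp L ι F x := by
  simp only [diracOp, dirDeriv_neg, map_neg, Finset.sum_neg_distrib]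

/-- `∂ ∂̄ = Δ`. -/
lemma diracOp_diracOp_eq_laplacianOp (h : IsCliffordPair L L') (hF : ContDiff ℝ 2 F) :
    diracOp L' ι (diracOp L ι F) = laplacianOp ι F := by
  funext x
  have hd : ∀ s, Differentiable ℝ (dirDeriv (ι (EuclideanSpace.single s 1)) F) := fun s =>
    (hF.dirDeriv (l := 1) (by norm_num) _).differentiable one_ne_zero
  have e : ∀ r, dirDeriv (ι (EuclideanSpace.single r 1)) (diracOp L ι F) x =
      ∑ s, L s (dirDeriv (ι (EuclideanSpace.single r 1))
        (dirDeriv (ι (EuclideanSpace.single s 1)) F) x) := by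
    intro r
    unfold diracOp
    rw [dirDeriv_sum_clm L hd]
  rw [diracOp]
  simp only [e, map_sum]
  exact h.sum_sum_eq fun r s => congrFun (dirDeriv_comm hF _ _) x

lemma dirDeriv_diracOp (hF : ContDiff ℝ 2 F) (w : X) :
    dirDeriv w (diracOp L ι F) = diracOp L ι (dirDeriv w F) := by
  funext x
  have hd : ∀ s, Differentiable ℝ (dirDeriv (ι (EuclideanSpace.single s 1)) F) := fun s =>
    (hF.dirDeriv (l := 1) (by norm_num) _).differentiable one_ne_zero
  unfold diracOp
  rw [dirDeriv_sum_clm L hd]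
  simp only [dirDeriv_comm hF w]

lemma diracOp_laplacianOp_comm (hF : ContDiff ℝ 3 F) :
    diracOp L ι (laplacianOp ι' F) = laplacianOp ι' (diracOp L ι F) := by
  funext x
  have h2 : ∀ w, ContDiff ℝ 2 (dirDeriv w F) := fun w => hF.dirDeriv (by norm_num) w
  have h1 : ∀ w w', Differentiable ℝ (dirDeriv w (dirDeriv w' F)) := fun w w' =>
    ((h2 w').dirDeriv (l := 1) (by norm_num) w).differentiable one_ne_zero
  have e : ∀ s, dirDeriv (ι' (EuclideanSpace.single s 1))
      (dirDeriv (ι' (EuclideanSpace.single s 1)) (diracOp L ι F)) x =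
      diracOp L ι (dirDeriv (ι' (EuclideanSpace.single s 1))
      (dirDeriv (ι' (EuclideanSpace.single s 1)) F)) x := by
    intro s
    rw [dirDeriv_diracOp (hF.of_le (by norm_num)), dirDeriv_diracOp (h2 _)]
  rw [laplacianOp]
  simp only [e]
  unfold diracOp laplacianOp
  rw [Finset.sum_comm]
  refine Finset.sum_congr rfl fun s _ => ?_
  rw [dirDeriv_finset_sum _ fun r _ => h1 _ _, map_sum]

lemma fderiv_comp_add_clm (hF : Differentiable ℝ F) (x : X)
    (y w : EuclideanSpace ℝ (Fin (m + 1))) :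
    fderiv ℝ (fun y => F (x + ι y)) y w = fderiv ℝ F (x + ι y) (ι w) := by
  have h1 : HasFDerivAt (fun y => x + ι y) ι y := ι.hasFDerivAt.const_add x
  have := ((hF (x + ι y)).hasFDerivAt.comp y h1).fderiv
  exact congrArg (fun T : _ →L[ℝ] V => T w) this

lemma diracOp_comp_add_clm (hF : Differentiable ℝ F) (x : X)
    (y : EuclideanSpace ℝ (Fin (m + 1))) :
    diracOp L (ContinuousLinearMap.id ℝ _) (fun y => F (x + ι y)) y = diracOp L ι F (x + ι y) := by
  simp only [diracOp, dirDeriv, fderiv_comp_add_clm hF, ContinuousLinearMap.id_apply]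

lemma cauchyOp_finset_sum {κ : Type*} (S : Finset κ) {G : κ → X → V} (hι : ∀ y, ‖y‖ ≤ ‖ι y‖)
    (hG : ∀ i ∈ S, Continuous (G i)) (hc : ∀ i ∈ S, HasCompactSupport (G i)) (x : X) :
    cauchyOp L' ι (fun x => ∑ i ∈ S, G i x) x = ∑ i ∈ S, cauchyOp L' ι (G i) x := by
  unfold cauchyOp kernelTransform
  simp only [Finset.smul_sum]
  rw [Finset.sum_comm]
  refine Finset.sum_congr rfl fun s _ => ?_
  rw [integral_finsetSum _ fun i hi => integrable_kernelTransform
    (locallyIntegrable_cauchyComponent m s) hι (hG i hi) (hc i hi) x, map_sum]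

variable [CompleteSpace V]

/-- **Cauchy–Pompeiu formula** for compactly supported functions, at the origin. -/
lemma sum_integral_cauchyComponent_smul_dirac (h : IsCliffordPair L L')
    {u : EuclideanSpace ℝ (Fin (m + 1)) → V} (hu : ContDiff ℝ 1 u) (hc : HasCompactSupport u) :
    ∑ r, L' r (∫ y, cauchyComponent m r y •
      diracOp L (ContinuousLinearMap.id ℝ _) u y) = - u 0 := by
  have hint : ∀ r s, Integrable (fun y => cauchyComponent m r y •
      fderiv ℝ u y (EuclideanSpace.single s 1)) := fun r s =>
    (locallyIntegrable_cauchyComponent m r).integrable_smul_right_of_hasCompactSupport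
      ((hu.continuous_fderiv one_ne_zero).clm_apply continuous_const) (hc.fderiv_apply ℝ _)
  have e : ∀ r, ∫ y, cauchyComponent m r y • diracOp L (ContinuousLinearMap.id ℝ _) u y =
      ∑ s, L s (∫ y, cauchyComponent m r y • fderiv ℝ u y (EuclideanSpace.single s 1)) := by
    intro r
    have : ∀ y, cauchyComponent m r y • diracOp L (ContinuousLinearMap.id ℝ _) u y =
        ∑ s, L s (cauchyComponent m r y • fderiv ℝ u y (EuclideanSpace.single s 1)) := by
      intro y
      simp [diracOp, dirDeriv, Finset.smul_sum]
    simp only [this]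
    rw [integral_finsetSum _ fun s _ => (L s).integrable_comp (hint r s)]
    exact Finset.sum_congr rfl fun s _ => (L s).integral_comp_comm (hint r s)
  simp only [e, map_sum]
  rw [h.sum_sum_eq fun r s => integral_cauchyComponent_smul_fderiv_comm hu hc r s]
  exact sum_integral_cauchyComponent_smul_fderiv hu hc

/-- **Cauchy–Pompeiu formula** in one of the variables. -/
lemma cauchyOp_diracOp (h : IsCliffordPair L L') (hF : ContDiff ℝ 1 F) (x : X)
    (hc : HasCompactSupport fun y => F (x + ι y)) :
    cauchyOp L' ι (diracOp L ι F) x = -F x := by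
  have hu : ContDiff ℝ 1 (fun y => F (x + ι y)) := hF.comp (contDiff_const.add ι.contDiff)
  have := sum_integral_cauchyComponent_smul_dirac h hu hc
  simp only [diracOp_comp_add_clm (hF.differentiable one_ne_zero), map_zero, add_zero] at this
  exact this

/-- A function annihilated by the Dirac operator of one variable vanishes on each slice on which
it has compact support. -/
lemma eq_zero_of_diracOp_eq_zero (h : IsCliffordPair L L') (hF : ContDiff ℝ 1 F) (x : X)
    (hc : HasCompactSupport fun y => F (x + ι y)) (h0 : ∀ y, diracOp L ι F (x + ι y) = 0) :
    F x = 0 := by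
  have := cauchyOp_diracOp h hF x hc
  simpa [cauchyOp, kernelTransform, h0] using this.symm

lemma dirDeriv_kernelTransform (hι : ∀ y, ‖y‖ ≤ ‖ι y‖)
    (hF : ContDiff ℝ 1 F) (hc : HasCompactSupport F) (r : Fin (m + 1)) (w : X) :
    dirDeriv w (kernelTransform volume (cauchyComponent m r) ι F) =
      kernelTransform volume (cauchyComponent m r) ι (dirDeriv w F) :=
  funext fun x =>
    fderiv_kernelTransform_apply (locallyIntegrable_cauchyComponent m r) hι hF hc x w

lemma dirDeriv_cauchyOp (hι : ∀ y, ‖y‖ ≤ ‖ι y‖)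
    (hF : ContDiff ℝ 1 F) (hc : HasCompactSupport F) (w : X) :
    dirDeriv w (cauchyOp L' ι F) = cauchyOp L' ι (dirDeriv w F) := by
  funext x
  have hd : ∀ r, Differentiable ℝ (kernelTransform volume (cauchyComponent m r) ι F) := fun r x =>
    (hasFDerivAt_kernelTransform (locallyIntegrable_cauchyComponent m r) hι hF hc
      x).differentiableAt
  unfold cauchyOp
  rw [dirDeriv_sum_clm L' hd]
  simp only [dirDeriv_kernelTransform hι hF hc]

/-- `f = -cauchyOp F` solves `∂̄ f = F`. -/
lemma diracOp_cauchyOp (h : IsCliffordPair L L') (hι : ∀ y, ‖y‖ ≤ ‖ι y‖)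
    (hF : ContDiff ℝ 1 F) (hc : HasCompactSupport F) (x : X) :
    diracOp L ι (cauchyOp L' ι F) x = -F x := by
  have hu : ContDiff ℝ 1 (fun y => F (x + ι y)) := hF.comp (contDiff_const.add ι.contDiff)
  have hcu := hc.comp_add_clm hι x
  have hd := hF.differentiable one_ne_zero
  unfold diracOp
  simp only [dirDeriv_cauchyOp hι hF hc]
  unfold cauchyOp kernelTransform
  simp only [map_sum]
  rw [h.symm.sum_sum_eq (c := fun r s => ∫ y, cauchyComponent m s y •
    dirDeriv (ι (EuclideanSpace.single r 1)) F (x + ι y))]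
  · have := sum_integral_cauchyComponent_smul_fderiv hu hcu
    simp only [fderiv_comp_add_clm hd, map_zero, add_zero] at this
    exact this
  · intro r s
    have := integral_cauchyComponent_smul_fderiv_comm hu hcu s r
    simp only [fderiv_comp_add_clm hd] at this
    exact this

lemma laplacianOp_cauchyOp (hι : ∀ y, ‖y‖ ≤ ‖ι y‖)
    (hF : ContDiff ℝ 2 F) (hc : HasCompactSupport F) (x : X) :
    laplacianOp ι' (cauchyOp L' ι F) x = cauchyOp L' ι (laplacianOp ι' F) x := by
  have h1 : ∀ w, ContDiff ℝ 1 (dirDeriv w F) := fun w => hF.dirDeriv (by norm_num) w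
  unfold laplacianOp
  rw [cauchyOp_finset_sum _ hι
    (fun s _ => ((h1 _).dirDeriv (l := 0) (by norm_num) _).continuous)
    (fun s _ => (hc.dirDeriv _).dirDeriv _)]
  refine Finset.sum_congr rfl fun s _ => ?_
  rw [dirDeriv_cauchyOp hι (hF.of_le (by norm_num)) hc, dirDeriv_cauchyOp hι (h1 _) (hc.dirDeriv _)]

end Dirac

/-! ### Unique continuation -/

section Holomorphic

lemma differentiableOn_integral_of_continuousOn_deriv {Z : Type*} [TopologicalSpace Z]
    [T2Space Z] [MeasurableSpace Z] [OpensMeasurableSpace Z] {μ : Measure Z}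
    [IsFiniteMeasureOnCompacts μ] {S : Set Z} (hS : IsCompact S)
    {Ω : Set ℂ} (hΩ : IsOpen Ω) {κ κ' : ℂ → Z → ℂ}
    (hκ : ContinuousOn (Function.uncurry κ) (Ω ×ˢ S))
    (hκ' : ContinuousOn (Function.uncurry κ') (Ω ×ˢ S))
    (hd : ∀ ζ ∈ Ω, ∀ z ∈ S, HasDerivAt (fun ζ => κ ζ z) (κ' ζ z) ζ) :
    DifferentiableOn ℂ (fun ζ => ∫ z in S, κ ζ z ∂μ) Ω := by
  intro ζ₀ hζ₀
  obtain ⟨r, hr, hrΩ⟩ := Metric.nhds_basis_closedBall.mem_iff.1 (hΩ.mem_nhds hζ₀)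
  obtain ⟨C, hC⟩ := ((isCompact_closedBall ζ₀ r).prod hS).exists_bound_of_continuousOn
    (hκ'.mono (Set.prod_mono hrΩ le_rfl))
  have hsec : ∀ {h : ℂ → Z → ℂ}, ContinuousOn (Function.uncurry h) (Ω ×ˢ S) → ∀ ζ ∈ Ω,
      ContinuousOn (h ζ) S := fun hh ζ hζ =>
    hh.comp (f := fun z => (ζ, z)) (by fun_prop) fun z hz => ⟨hζ, hz⟩
  have hint : IntegrableOn (fun _ : Z => C) S μ :=
    integrableOn_const hS.measure_lt_top.ne (by simp)
  refine (hasDerivAt_integral_of_dominated_loc_of_deriv_le (F := κ) (F' := κ')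
    (μ := μ.restrict S) (bound := fun _ => C) (Metric.ball_mem_nhds ζ₀ hr) ?_ ?_ ?_ ?_ hint
    ?_).2.differentiableAt.differentiableWithinAt
  · filter_upwards [hΩ.mem_nhds hζ₀] with ζ hζ
    exact (hsec hκ ζ hζ).aestronglyMeasurable_of_isCompact hS hS.measurableSet
  · exact (hsec hκ ζ₀ hζ₀).integrableOn_compact' hS hS.measurableSet
  · exact (hsec hκ' ζ₀ hζ₀).aestronglyMeasurable_of_isCompact hS hS.measurableSet
  · filter_upwards [ae_restrict_mem hS.measurableSet] with z hz ζ hζ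
    exact hC (ζ, z) ⟨Metric.ball_subset_closedBall hζ, hz⟩
  · filter_upwards [ae_restrict_mem hS.measurableSet] with z hz ζ hζ
    exact hd ζ (hrΩ (Metric.ball_subset_closedBall hζ)) z hz

variable {m : ℕ}

/-- The polynomial in `ζ` that extends `|z - (q + t w)|²` from real to complex `t = ζ`. -/
noncomputable def complexSqDist (q w z : EuclideanSpace ℝ (Fin (m + 1))) (ζ : ℂ) : ℂ :=
  ((‖z - q‖ ^ 2 : ℝ) : ℂ) - 2 * ζ * (inner ℝ (z - q) w : ℝ) + ζ ^ 2 * ((‖w‖ ^ 2 : ℝ) : ℂ)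

lemma complexSqDist_re (q w z : EuclideanSpace ℝ (Fin (m + 1))) (ζ : ℂ) :
    (complexSqDist q w z ζ).re = ‖z - (q + ζ.re • w)‖ ^ 2 - (|ζ.im| * ‖w‖) ^ 2 := by
  have h : z - (q + ζ.re • w) = (z - q) - ζ.re • w := by abel
  rw [h, norm_sub_sq_real, inner_smul_right, norm_smul, mul_pow, mul_pow, sq_abs,
    Real.norm_eq_abs, sq_abs]
  simp [complexSqDist, pow_two]
  ring

lemma complexSqDist_ofReal (q w z : EuclideanSpace ℝ (Fin (m + 1))) (t : ℝ) :
    complexSqDist q w z t = ((‖z - (q + t • w)‖ ^ 2 : ℝ) : ℂ) := by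
  have h : z - (q + t • w) = (z - q) - t • w := by abel
  rw [h, norm_sub_sq_real, inner_smul_right, norm_smul, mul_pow, Real.norm_eq_abs, sq_abs,
    complexSqDist]
  push_cast
  ring

/-- The complex neighbourhood of a segment to which the potential of a density supported off
`ball p R` extends; `w` is the direction of the segment. -/
def segmentNhd (p q w : EuclideanSpace ℝ (Fin (m + 1))) (R R' : ℝ) : Set ℂ :=
  {ζ | ‖q + ζ.re • w - p‖ < R' ∧ |ζ.im| * ‖w‖ < R - R'}

lemma isOpen_segmentNhd (p q w : EuclideanSpace ℝ (Fin (m + 1))) (R R' : ℝ) :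
    IsOpen (segmentNhd p q w R R') := by
  have h1 : Continuous fun ζ : ℂ => ‖q + ζ.re • w - p‖ := by
    have := Complex.continuous_re
    fun_prop
  have h2 : Continuous fun ζ : ℂ => |ζ.im| * ‖w‖ := by
    have := Complex.continuous_im
    fun_prop
  exact (isOpen_lt h1 continuous_const).inter (isOpen_lt h2 continuous_const)

lemma convex_segmentNhd (p q w : EuclideanSpace ℝ (Fin (m + 1))) (R R' : ℝ) :
    Convex ℝ (segmentNhd p q w R R') := by
  rintro ζ ⟨h1, h2⟩ ξ ⟨h3, h4⟩ a b ha hb hab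
  have key : ∀ {x y c : ℝ}, x < c → y < c → a * x + b * y < c := by
    intro x y c hx hy
    have h : c = a * c + b * c := by rw [← add_mul, hab, one_mul]
    rcases ha.eq_or_lt with rfl | ha'
    · have : b = 1 := by linarith
      simpa [this] using hy
    · nlinarith
  constructor
  · have e : q + (a • ζ + b • ξ).re • w - p =
        a • (q + ζ.re • w - p) + b • (q + ξ.re • w - p) := by
      have hb' : b = 1 - a := by linarith
      subst hb'
      simp only [Complex.add_re, Complex.real_smul, Complex.re_ofReal_mul]
      module
    rw [e]
    refine lt_of_le_of_lt (norm_add_le _ _) ?_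
    rw [norm_smul, norm_smul, Real.norm_of_nonneg ha, Real.norm_of_nonneg hb]
    exact key h1 h3
  · have e : (a • ζ + b • ξ).im = a * ζ.im + b * ξ.im := by simp
    rw [e]
    have : |a * ζ.im + b * ξ.im| ≤ a * |ζ.im| + b * |ξ.im| := by
      refine (abs_add_le _ _).trans ?_
      rw [abs_mul, abs_mul, abs_of_nonneg ha, abs_of_nonneg hb]
    calc _ ≤ (a * |ζ.im| + b * |ξ.im|) * ‖w‖ := by gcongr
      _ = a * (|ζ.im| * ‖w‖) + b * (|ξ.im| * ‖w‖) := by ring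
      _ < _ := key h2 h4

lemma complexSqDist_re_pos {p q w z : EuclideanSpace ℝ (Fin (m + 1))} {R R' : ℝ} {ζ : ℂ}
    (hζ : ζ ∈ segmentNhd p q w R R') (hz : z ∉ Metric.ball p R) :
    0 < (complexSqDist q w z ζ).re := by
  obtain ⟨h1, h2⟩ := hζ
  rw [complexSqDist_re, sub_pos]
  have h3 : R ≤ ‖z - p‖ := by
    rw [mem_ball_iff_norm] at hz
    exact not_lt.1 hz
  have h4 : ‖z - p‖ ≤ ‖z - (q + ζ.re • w)‖ + ‖q + ζ.re • w - p‖ := by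
    have := norm_add_le (z - (q + ζ.re • w)) (q + ζ.re • w - p)
    rwa [sub_add_sub_cancel] at this
  have h5 : 0 ≤ |ζ.im| * ‖w‖ := by positivity
  gcongr
  linarith

/-- Along a segment in `ball p R`, the potential of a density that vanishes on `ball p R` is the
restriction of a holomorphic function. -/
lemma exists_holomorphic_extension_potential (s : Fin (m + 1))
    {p q w : EuclideanSpace ℝ (Fin (m + 1))} {R R' : ℝ}
    {ρ : EuclideanSpace ℝ (Fin (m + 1)) → ℝ} (hρ : Continuous ρ) (hc : HasCompactSupport ρ)
    (h0 : ∀ z ∈ Metric.ball p R, ρ z = 0) :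
    ∃ Φ : ℂ → ℂ, DifferentiableOn ℂ Φ (segmentNhd p q w R R') ∧
      ∀ t : ℝ, (t : ℂ) ∈ segmentNhd p q w R R' →
        Φ t = ((∫ z, cauchyComponent m s (z - (q + t • w)) * ρ z : ℝ) : ℂ) := by
  set S : Set (EuclideanSpace ℝ (Fin (m + 1))) := tsupport ρ \ Metric.ball p R
  have hS : IsCompact S := IsCompact.diff hc Metric.isOpen_ball
  set a : ℂ := -((((m + 1 : ℕ) : ℝ) / 2 : ℝ) : ℂ) with ha
  set c : ℂ := (((sphereArea m)⁻¹ : ℝ) : ℂ) with hcdef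
  set Ω := segmentNhd p q w R R'
  let P : ℂ → EuclideanSpace ℝ (Fin (m + 1)) → ℂ := fun ζ z => complexSqDist q w z ζ
  -- `P'` is the derivative of `P` in `ζ`; `N` extends the numerator `(z - (q + t w))_s`
  let P' : ℂ → EuclideanSpace ℝ (Fin (m + 1)) → ℂ := fun ζ z =>
    - 2 * (inner ℝ (z - q) w : ℝ) + 2 * ζ * ((‖w‖ ^ 2 : ℝ) : ℂ)
  let N : ℂ → EuclideanSpace ℝ (Fin (m + 1)) → ℂ := fun ζ z =>
    (((z - q) s : ℝ) : ℂ) - ζ * ((w s : ℝ) : ℂ)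
  have hslit : ∀ x ∈ Ω ×ˢ S, P x.1 x.2 ∈ Complex.slitPlane := fun x hx =>
    Or.inl (complexSqDist_re_pos hx.1 hx.2.2)
  have hPc : Continuous (Function.uncurry P) := by
    unfold P complexSqDist Function.uncurry
    fun_prop
  have hPc' : Continuous (Function.uncurry P') := by
    unfold P' Function.uncurry
    fun_prop
  have hNc : Continuous (Function.uncurry N) := by
    unfold N Function.uncurry
    fun_prop
  have hρc : Continuous (fun x : ℂ × EuclideanSpace ℝ (Fin (m + 1)) => (ρ x.2 : ℂ)) := by
    fun_prop
  have hpow : ∀ b : ℂ, ContinuousOn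
      (fun x : ℂ × EuclideanSpace ℝ (Fin (m + 1)) => P x.1 x.2 ^ b) (Ω ×ˢ S) := fun b x hx =>
    (ContinuousAt.cpow hPc.continuousAt continuousAt_const (hslit x hx)).continuousWithinAt
  refine ⟨fun ζ => ∫ z in S, c * (N ζ z * P ζ z ^ a) * ρ z, ?_, ?_⟩
  · refine differentiableOn_integral_of_continuousOn_deriv hS (isOpen_segmentNhd p q w R R')
      (κ' := fun ζ z => c * ((-((w s : ℝ) : ℂ)) * P ζ z ^ a +
        N ζ z * (a * P ζ z ^ (a - 1) * P' ζ z)) * ρ z) ?_ ?_ ?_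
    · exact (continuousOn_const.mul (hNc.continuousOn.mul (hpow a))).mul hρc.continuousOn
    · exact (continuousOn_const.mul ((continuousOn_const.mul (hpow a)).add
        (hNc.continuousOn.mul ((continuousOn_const.mul (hpow (a - 1))).mul
          hPc'.continuousOn)))).mul hρc.continuousOn
    · intro ζ hζ z hz
      have hP : HasDerivAt (fun ζ => P ζ z) (P' ζ z) ζ := by
        have h1 : HasDerivAt (fun ζ : ℂ => 2 * ζ * ((inner ℝ (z - q) w : ℝ) : ℂ))
            (2 * 1 * ((inner ℝ (z - q) w : ℝ) : ℂ)) ζ :=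
          ((hasDerivAt_id ζ).const_mul 2).mul_const _
        have h2 : HasDerivAt (fun ζ : ℂ => ζ ^ 2 * ((‖w‖ ^ 2 : ℝ) : ℂ))
            (((2 : ℕ) : ℂ) * ζ ^ (2 - 1) * 1 * ((‖w‖ ^ 2 : ℝ) : ℂ)) ζ :=
          ((hasDerivAt_id ζ).pow 2).mul_const _
        have h3 := (h1.const_sub ((‖z - q‖ ^ 2 : ℝ) : ℂ)).add h2
        refine h3.congr_deriv ?_
        simp only [P']
        push_cast
        ring
      have hN : HasDerivAt (fun ζ => N ζ z) (-((w s : ℝ) : ℂ)) ζ := by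
        have h1 := ((hasDerivAt_id ζ).mul_const ((w s : ℝ) : ℂ)).const_sub
          (((z - q) s : ℝ) : ℂ)
        refine h1.congr_deriv ?_
        ring
      have hpw := hP.cpow_const (c := a) (hslit (ζ, z) ⟨hζ, hz⟩)
      exact ((hN.mul hpw).const_mul c).mul_const _
  · intro t ht
    rw [← integral_complex_ofReal, ← setIntegral_eq_integral_of_forall_compl_eq_zero (s := S)]
    · refine setIntegral_congr_fun hS.measurableSet fun z hz => ?_
      have hre := complexSqDist_re_pos ht hz.2
      have hne : 0 < ‖z - (q + t • w)‖ := by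
        rw [norm_pos_iff]
        intro h
        rw [complexSqDist_ofReal, h] at hre
        simp at hre
      have e1 : P t z ^ a = (((‖z - (q + t • w)‖ ^ (m + 1))⁻¹ : ℝ) : ℂ) := by
        simp only [P, ha]
        rw [complexSqDist_ofReal, ← Complex.ofReal_neg, ← Complex.ofReal_cpow (by positivity)]
        congr 1
        rw [← Real.rpow_natCast, ← Real.rpow_natCast _ (m + 1), ← Real.rpow_neg (norm_nonneg _),
          ← Real.rpow_mul (norm_nonneg _)]
        congr 1
        push_cast
        ring
      have e2 : N t z = (((z - (q + t • w)) s : ℝ) : ℂ) := by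
        simp only [N, PiLp.sub_apply, PiLp.add_apply, PiLp.smul_apply, smul_eq_mul]
        push_cast
        ring
      simp only [e1, e2, hcdef]
      rw [cauchyComponent]
      push_cast
      field_simp
    · intro z hz
      have : ρ z = 0 := by
        by_cases hb : z ∈ Metric.ball p R
        · exact h0 z hb
        · exact image_eq_zero_of_notMem_tsupport fun h => hz ⟨h, hb⟩
      simp [this]

/-- The potentials of densities that vanish on a ball are real-analytic on the ball: they vanish on
the ball if they vanish near one of its points. -/
lemma sum_potential_eq_zero_of_eventually {p q x : EuclideanSpace ℝ (Fin (m + 1))} {R : ℝ}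
    {ρ : Fin (m + 1) → EuclideanSpace ℝ (Fin (m + 1)) → ℝ} (hρ : ∀ s, Continuous (ρ s))
    (hc : ∀ s, HasCompactSupport (ρ s)) (h0 : ∀ s, ∀ z ∈ Metric.ball p R, ρ s z = 0)
    (hq : q ∈ Metric.ball p R) (hx : x ∈ Metric.ball p R)
    (hev : ∀ᶠ y in nhds q, ∑ s, ∫ z, cauchyComponent m s (z - y) * ρ s z = 0) :
    ∑ s, ∫ z, cauchyComponent m s (z - x) * ρ s z = 0 := by
  rw [mem_ball_iff_norm] at hq hx
  set w := x - q
  -- the margin `R - R'` keeps the real part of the extended squared distance positive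
  obtain ⟨R', h1, h2⟩ := exists_between (max_lt hq hx)
  rw [max_lt_iff] at h1
  choose Φ hΦ hΦt using fun s =>
    exists_holomorphic_extension_potential (q := q) (w := w) (R' := R') s (hρ s) (hc s) (h0 s)
  set Ω := segmentNhd p q w R R'
  have h0Ω : (0 : ℂ) ∈ Ω := by
    simp only [Ω, segmentNhd, Set.mem_ofPred_eq, Complex.zero_re, Complex.zero_im, zero_smul,
      add_zero, abs_zero, zero_mul]
    exact ⟨h1.1, by linarith⟩
  have h1Ω : (1 : ℂ) ∈ Ω := by
    simp only [Ω, segmentNhd, Set.mem_ofPred_eq, Complex.one_re, Complex.one_im, one_smul,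
      abs_zero, zero_mul, w, add_sub_cancel]
    exact ⟨h1.2, by linarith⟩
  have hΩ : IsOpen Ω := isOpen_segmentNhd p q w R R'
  -- the sum of the extensions is analytic on a connected set that contains `0` and `1`, and
  -- vanishes for small real arguments
  have han : AnalyticOnNhd ℂ (fun ζ => ∑ s, Φ s ζ) Ω :=
    (DifferentiableOn.fun_sum fun s _ => hΦ s).analyticOnNhd hΩ
  have hval : ∀ t : ℝ, (t : ℂ) ∈ Ω → ∑ s, Φ s t =
      ((∑ s, ∫ z, cauchyComponent m s (z - (q + t • w)) * ρ s z : ℝ) : ℂ) := by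
    intro t ht
    rw [Complex.ofReal_sum]
    exact Finset.sum_congr rfl fun s _ => hΦt s t ht
  have hline : Filter.Tendsto (fun t : ℝ => q + t • w) (nhds 0) (nhds q) := by
    have : Continuous (fun t : ℝ => q + t • w) := by fun_prop
    simpa using this.tendsto 0
  have hof : Filter.Tendsto (fun t : ℝ => (t : ℂ)) (nhds 0) (nhds 0) := by
    simpa using Complex.continuous_ofReal.tendsto 0
  have hzero : ∀ᶠ t : ℝ in nhds 0, ∑ s, Φ s (t : ℂ) = 0 := by
    filter_upwards [hline.eventually hev, hof.eventually (hΩ.mem_nhds h0Ω)] with t ht ht'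
    rw [hval t ht', ht, Complex.ofReal_zero]
  have hof' : Filter.Tendsto (fun t : ℝ => (t : ℂ)) (nhdsWithin 0 {0}ᶜ)
      (nhdsWithin 0 {0}ᶜ) := by
    refine tendsto_nhdsWithin_iff.2 ⟨hof.mono_left nhdsWithin_le_nhds, ?_⟩
    filter_upwards [self_mem_nhdsWithin] with t ht
    simpa using ht
  have hfreq : ∃ᶠ ζ in nhdsWithin (0 : ℂ) {0}ᶜ, ∑ s, Φ s ζ = 0 :=
    hof'.frequently (hzero.filter_mono nhdsWithin_le_nhds).frequently
  have := han.eqOn_zero_of_preconnected_of_frequently_eq_zero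
    (convex_segmentNhd p q w R R').isPreconnected h0Ω hfreq h1Ω
  have hv := hval 1 (by simpa using h1Ω)
  simp only [Complex.ofReal_one] at hv
  simp only [Pi.zero_apply] at this
  rw [this] at hv
  have hv' := Complex.ofReal_eq_zero.1 hv.symm
  simpa [w] using hv'

/-- Unique continuation for one Clifford variable. -/
lemma eq_zero_on_ball_of_dirac_eq_zero {V : Type*} [NormedAddCommGroup V] [NormedSpace ℝ V]
    [CompleteSpace V] {L L' : Fin (m + 1) → V →L[ℝ] V} (h : IsCliffordPair L L')
    {u : EuclideanSpace ℝ (Fin (m + 1)) → V} (hu : ContDiff ℝ 1 u) (hc : HasCompactSupport u)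
    {p q x : EuclideanSpace ℝ (Fin (m + 1))} {R : ℝ}
    (h0 : ∀ z ∈ Metric.ball p R, diracOp L (ContinuousLinearMap.id ℝ _) u z = 0)
    (hq : q ∈ Metric.ball p R) (hx : x ∈ Metric.ball p R) (hev : ∀ᶠ y in nhds q, u y = 0) :
    u x = 0 := by
  refine SeparatingDual.eq_zero_of_forall_dual_eq_zero (R := ℝ) fun ℓ => ?_
  set D := diracOp L (ContinuousLinearMap.id ℝ _) u
  have hDc : Continuous D := (hu.diracOp (l := 0) (by norm_num) L _).continuous
  have hDs : HasCompactSupport D := hc.diracOp L _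
  let ρ : Fin (m + 1) → EuclideanSpace ℝ (Fin (m + 1)) → ℝ := fun s z => ℓ (L' s (D z))
  have key : ∀ y, ℓ (u y) = -∑ s, ∫ z, cauchyComponent m s (z - y) * ρ s z := by
    intro y
    have h1 := cauchyOp_diracOp (ι := ContinuousLinearMap.id ℝ _) h hu y
      (hc.comp_add_clm (fun _ => le_rfl) y)
    have h2 : u y = -cauchyOp L' (ContinuousLinearMap.id ℝ _) D y := by rw [h1, neg_neg]
    rw [h2, cauchyOp, map_neg, map_sum]
    congr 1
    refine Finset.sum_congr rfl fun s _ => ?_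
    have h3 := kernelTransform_clm_comp (ι := ContinuousLinearMap.id ℝ _) (ℓ.comp (L' s))
      (locallyIntegrable_cauchyComponent m s) (fun _ => le_rfl) hDc hDs y
    simp only [ContinuousLinearMap.comp_apply] at h3
    rw [← h3, kernelTransform,
      ← integral_add_left_eq_self (fun z => cauchyComponent m s (z - y) * ρ s z) y]
    simp [ρ]
  rw [key, neg_eq_zero]
  refine sum_potential_eq_zero_of_eventually (ρ := ρ)
    (fun s => ℓ.continuous.comp ((L' s).continuous.comp hDc)) (fun s => ?_)
    (fun s z hz => by simp [ρ, D, h0 z hz]) hq hx ?_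
  · exact hDs.comp_left (g := fun a => ℓ (L' s a)) (by simp)
  · filter_upwards [hev] with y hy
    have := key y
    rw [hy, map_zero] at this
    linarith

end Holomorphic

/-! ### The overdetermined system in several Clifford variables -/

section System

variable {n m : ℕ}

/-- The inclusion of the `j`-th variable. -/
noncomputable def varIncl (m : ℕ) (j : Fin n) :
    EuclideanSpace ℝ (Fin (m + 1)) →L[ℝ] HyperSpace n m :=
  ContinuousLinearMap.single ℝ (fun _ => EuclideanSpace ℝ (Fin (m + 1))) j

lemma varIncl_apply (j : Fin n) (y : EuclideanSpace ℝ (Fin (m + 1))) :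
    varIncl m j y = Pi.single j y := rfl

lemma norm_le_norm_varIncl (j : Fin n) (y : EuclideanSpace ℝ (Fin (m + 1))) :
    ‖y‖ ≤ ‖varIncl m j y‖ := by
  simpa [varIncl_apply] using norm_le_pi_norm (Pi.single j y : HyperSpace n m) j

lemma add_varIncl_eq_update (j : Fin n) (x : HyperSpace n m)
    (y : EuclideanSpace ℝ (Fin (m + 1))) :
    x + varIncl m j y = Function.update x j (y + x j) := by
  funext i
  rcases eq_or_ne i j with rfl | h
  · simp [varIncl_apply, add_comm]
  · simp [varIncl_apply, h]

lemma add_varIncl_of_ne {i j : Fin n} (h : j ≠ i) (x : HyperSpace n m)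
    (y : EuclideanSpace ℝ (Fin (m + 1))) : (x + varIncl m i y) j = x j := by
  simp [varIncl_apply, h]

lemma eq_zero_of_lt_norm_apply {V : Type*} [Zero V]
    {F : HyperSpace n m → V} {R : ℝ}
    (hR : tsupport F ⊆ Metric.closedBall 0 R) {x : HyperSpace n m} {j : Fin n} (hx : R < ‖x j‖) :
    F x = 0 := by
  by_contra h
  have h1 : ‖x‖ ≤ R := by simpa using hR (subset_tsupport _ h)
  exact absurd ((norm_le_pi_norm x j).trans h1) (not_le.2 hx)

lemma hasCompactSupport_slice {V : Type*} [Zero V]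
    {F : HyperSpace n m → V} {j : Fin n} {R : ℝ}
    (hF : ∀ x : HyperSpace n m, R < ‖x j‖ → F x = 0) (x : HyperSpace n m) :
    HasCompactSupport fun y => F (x + varIncl m j y) := by
  refine HasCompactSupport.of_support_subset_isCompact
    (isCompact_closedBall (0 : EuclideanSpace ℝ (Fin (m + 1))) (R + ‖x j‖)) fun y hy => ?_
  by_contra h
  refine hy (hF _ ?_)
  have h1 : R + ‖x j‖ < ‖y‖ := by simpa using h
  have h2 : ‖y‖ ≤ ‖y + x j‖ + ‖x j‖ := by simpa using norm_sub_le (y + x j) (x j)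
  rw [add_varIncl_eq_update, Function.update_self]
  linarith

variable {V : Type*} [NormedAddCommGroup V] [NormedSpace ℝ V]

lemma cauchyOp_eq_zero_of_lt_norm_apply {L' : Fin (m + 1) → V →L[ℝ] V} {F : HyperSpace n m → V}
    {R : ℝ} (hR : tsupport F ⊆ Metric.closedBall 0 R) {x : HyperSpace n m} {i j : Fin n}
    (hij : j ≠ i) (hx : R < ‖x j‖) : cauchyOp L' (varIncl m i) F x = 0 := by
  have : ∀ y, F (x + varIncl m i y) = 0 := fun y =>
    eq_zero_of_lt_norm_apply (j := j) hR (by rwa [add_varIncl_of_ne hij])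
  simp [cauchyOp, kernelTransform, this]

lemma contDiff_cauchyOp {V : Type} [NormedAddCommGroup V] [NormedSpace ℝ V]
    {L' : Fin (m + 1) → V →L[ℝ] V} {i : Fin n} {F : HyperSpace n m → V} {k : ℕ∞}
    (hF : ContDiff ℝ k F) (hc : HasCompactSupport F) :
    ContDiff ℝ k (cauchyOp L' (varIncl m i) F) :=
  ContDiff.sum fun s _ => (L' s).contDiff.comp
    (contDiff_kernelTransform (locallyIntegrable_cauchyComponent m s) (norm_le_norm_varIncl i)
      hF hc)

variable {L L' : Fin (m + 1) → V →L[ℝ] V} {G : Fin n → HyperSpace n m → V}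

/-- Since `n > 1`, there is another variable in which the solution `f = -cauchyOp (G i)` has
compact slices; where the `i`-th coordinate is large, `f` is annihilated by the corresponding Dirac
operator and hence vanishes. -/
lemma hasCompactSupport_of_eq_neg_cauchyOp [CompleteSpace V] (h : IsCliffordPair L L') (hn : 1 < n)
    (hGc : ∀ j, HasCompactSupport (G j)) (i : Fin n) {f : HyperSpace n m → V} (hf : ContDiff ℝ 1 f)
    (hfi : ∀ x, f x = -cauchyOp L' (varIncl m i) (G i) x)
    (hsol : ∀ j x, diracOp L (varIncl m j) f x = G j x) : HasCompactSupport f := by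
  have hb : Bornology.IsBounded (⋃ j, tsupport (G j)) :=
    (isCompact_iUnion fun j => (hGc j).isCompact).isBounded
  obtain ⟨R, hR⟩ := hb.subset_closedBall 0
  have hRj : ∀ j, tsupport (G j) ⊆ Metric.closedBall 0 R := fun j =>
    (Set.subset_iUnion (fun j => tsupport (G j)) j).trans hR
  have h1 : ∀ j, j ≠ i → ∀ x : HyperSpace n m, R < ‖x j‖ → f x = 0 := fun j hj x hx => by
    rw [hfi, cauchyOp_eq_zero_of_lt_norm_apply (hRj i) hj hx, neg_zero]
  -- this is where `n > 1` is used: there is a variable `l ≠ i`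
  have h2 : ∀ x : HyperSpace n m, R < ‖x i‖ → f x = 0 := fun x hx => by
    have : Nontrivial (Fin n) := Fin.nontrivial_iff_two_le.2 hn
    obtain ⟨l, hl⟩ := exists_ne i
    refine eq_zero_of_diracOp_eq_zero h hf x (hasCompactSupport_slice (h1 l hl) x) fun y => ?_
    rw [hsol]
    exact eq_zero_of_lt_norm_apply (j := i) (hRj l) (by rwa [add_varIncl_of_ne hl.symm])
  refine HasCompactSupport.of_support_subset_isCompact
    (isCompact_closedBall (0 : HyperSpace n m) (max R 0)) fun x hx => ?_
  simp only [Metric.mem_closedBall, dist_zero_right]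
  refine (pi_norm_le_iff_of_nonneg (le_max_right _ _)).2 fun j => ?_
  by_contra hj
  have hj' : R < ‖x j‖ := (le_max_left _ _).trans_lt (not_le.1 hj)
  rcases eq_or_ne j i with rfl | hji
  · exact hx (h2 x hj')
  · exact hx (h1 j hji x hj')

/-- The compatibility conditions make `∂̄_j f - G_j`, for `f = -cauchyOp (G i)`, a function with
compact slices that is annihilated by `∂_j`. -/
lemma diracOp_neg_cauchyOp_of_compatible [CompleteSpace V] (h : IsCliffordPair L L')
    (hG : ∀ j, ContDiff ℝ 3 (G j))
    (hGc : ∀ j, HasCompactSupport (G j)) {i j : Fin n} (hij : j ≠ i)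
    (hT : ContDiff ℝ 3 (cauchyOp L' (varIncl m i) (G i)))
    (hcomp : ∀ x, diracOp L (varIncl m i) (diracOp L' (varIncl m j) (G j)) x =
      laplacianOp (varIncl m j) (G i) x) (x : HyperSpace n m) :
    diracOp L (varIncl m j) (cauchyOp L' (varIncl m i) (G i)) x = -G j x := by
  set f := cauchyOp L' (varIncl m i) (G i) with hf
  obtain ⟨R, hR⟩ := (hGc i).isCompact.isBounded.subset_closedBall 0
  have hDf : ContDiff ℝ 2 (diracOp L (varIncl m j) f) := hT.diracOp (by norm_num) _ _
  let F : HyperSpace n m → V := fun x => diracOp L (varIncl m j) f x - -G j x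
  have hF : ContDiff ℝ 1 F := (hDf.of_le (by norm_num)).sub ((hG j).of_le (by norm_num)).neg
  have hfs : HasCompactSupport fun y => f (x + varIncl m j y) :=
    hasCompactSupport_slice (fun x hx => cauchyOp_eq_zero_of_lt_norm_apply hR hij hx) x
  have hFs : HasCompactSupport fun y => F (x + varIncl m j y) := by
    have h1 := hfs.diracOp L (ContinuousLinearMap.id ℝ _)
    have h2 : HasCompactSupport fun y => -G j (x + varIncl m j y) :=
      ((hGc j).comp_add_clm (norm_le_norm_varIncl j) x).neg
    have e : (fun y => F (x + varIncl m j y)) =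
        diracOp L (ContinuousLinearMap.id ℝ _) (fun y => f (x + varIncl m j y)) -
          fun y => -G j (x + varIncl m j y) := by
      funext y
      simp only [F, Pi.sub_apply]
      rw [diracOp_comp_add_clm (hT.differentiable (by norm_num))]
    rw [e]
    exact h1.sub h2
  have hD'G : ContDiff ℝ 2 (diracOp L' (varIncl m j) (G j)) := (hG j).diracOp (by norm_num) _ _
  have hlap : ∀ x, laplacianOp (varIncl m j) f x = -diracOp L' (varIncl m j) (G j) x := by
    intro x
    rw [hf, laplacianOp_cauchyOp (norm_le_norm_varIncl i) ((hG i).of_le (by norm_num)) (hGc i),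
      ← funext hcomp]
    exact cauchyOp_diracOp h (hD'G.of_le (by norm_num)) x
      (((hGc j).diracOp _ _).comp_add_clm (norm_le_norm_varIncl i) x)
  have hF0 : ∀ x, diracOp L' (varIncl m j) F x = 0 := by
    intro x
    rw [diracOp_sub (hDf.differentiable (by norm_num))
        ((hG j).differentiable (by norm_num)).fun_neg,
      diracOp_diracOp_eq_laplacianOp h (hT.of_le (by norm_num)), hlap, diracOp_neg, sub_self]
  have := eq_zero_of_diracOp_eq_zero h.symm hF x hFs fun y => hF0 _
  exact sub_eq_zero.1 this

/-- Unique continuation in a box, one variable at a time. -/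
lemma eq_zero_on_box [CompleteSpace V] (h : IsCliffordPair L L') {f : HyperSpace n m → V}
    (hf : ContDiff ℝ 1 f) (hfc : HasCompactSupport f) {p q : HyperSpace n m} {R : ℝ} (hR : 0 < R)
    (h0 : ∀ j, ∀ x ∈ Metric.ball p R, diracOp L (varIncl m j) f x = 0)
    (hq : q ∈ Metric.ball p R) (hev : ∀ᶠ y in nhds q, f y = 0) :
    ∀ x ∈ Metric.ball p R, f x = 0 := by
  obtain ⟨r, hr, hrq⟩ := Metric.eventually_nhds_iff_ball.1
    (hev.and (Metric.isOpen_ball.mem_nhds hq))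
  have hbox : ∀ {x c : HyperSpace n m} {ρ : ℝ}, 0 < ρ →
      (x ∈ Metric.ball c ρ ↔ ∀ i, x i ∈ Metric.ball (c i) ρ) := fun hρ => by
    simp only [Metric.mem_ball]
    exact dist_pi_lt_iff hρ
  have key : ∀ S : Finset (Fin n), ∀ x ∈ Metric.ball p R,
      (∀ i, i ∉ S → x i ∈ Metric.ball (q i) r) → f x = 0 := by
    intro S
    induction S using Finset.induction_on with
    | empty =>
      intro x _ hx
      exact (hrq x ((hbox hr).2 fun i => hx i (Finset.notMem_empty i))).1
    | insert j S _ ih =>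
      intro x hxp hx
      have hupd : ∀ z ∈ Metric.ball (p j) R, Function.update x j z ∈ Metric.ball p R := by
        intro z hz
        refine (hbox hR).2 fun i => ?_
        rcases eq_or_ne i j with rfl | hij
        · simpa using hz
        · simpa [hij] using (hbox hR).1 hxp i
      -- freeze all variables but the `j`-th and continue in the latter
      set x₀ : HyperSpace n m := Function.update x j 0
      have hx₀ : ∀ z, x₀ + varIncl m j z = Function.update x j z := by
        intro z
        simp [add_varIncl_eq_update, x₀]
      have hu : ContDiff ℝ 1 (fun z => f (x₀ + varIncl m j z)) :=
        hf.comp (contDiff_const.add (varIncl m j).contDiff)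
      have := eq_zero_on_ball_of_dirac_eq_zero (p := p j) (q := q j) (x := x j) (R := R) h hu
        (hfc.comp_add_clm (norm_le_norm_varIncl j) x₀) (fun z hz => ?_)
        ((hbox hR).1 hq j) ((hbox hR).1 hxp j) ?_
      · simpa [hx₀] using this
      · rw [diracOp_comp_add_clm (hf.differentiable one_ne_zero), hx₀]
        exact h0 j _ (hupd z hz)
      · have hqj : q j ∈ Metric.ball (q j) r ∩ Metric.ball (p j) R :=
          ⟨Metric.mem_ball_self hr, (hbox hR).1 hq j⟩
        filter_upwards [(Metric.isOpen_ball.inter Metric.isOpen_ball).mem_nhds hqj] with z hz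
        rw [hx₀]
        refine ih _ (hupd z hz.2) fun i hi => ?_
        rcases eq_or_ne i j with rfl | hij
        · simpa using hz.1
        · simpa [hij] using hx i (by simp [hij, hi])
  exact fun x hx => key Finset.univ x hx fun i hi => absurd (Finset.mem_univ i) hi

/-- A compactly supported function that is annihilated by all Dirac operators on an unbounded
connected open set vanishes there: it vanishes near some point, and unique continuation applies. -/
lemma eq_zero_of_isPreconnected_of_not_isBounded [CompleteSpace V] (h : IsCliffordPair L L')
    {f : HyperSpace n m → V} (hf : ContDiff ℝ 1 f) (hfc : HasCompactSupport f)
    {U : Set (HyperSpace n m)} (hU : IsOpen U) (hUc : IsPreconnected U)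
    (hUb : ¬ Bornology.IsBounded U)
    (h0 : ∀ j, ∀ x ∈ U, diracOp L (varIncl m j) f x = 0) : ∀ x ∈ U, f x = 0 := by
  obtain ⟨a, haU, ha⟩ : ∃ a ∈ U, a ∉ tsupport f := by
    by_contra! hcon
    exact hUb (hfc.isCompact.isBounded.subset hcon)
  have hsub : U ⊆ {x | ∀ᶠ y in nhds x, f y = 0} := by
    refine hUc.subset_of_closure_inter_subset isOpen_setOfPred_eventually_nhds
      ⟨a, haU, notMem_tsupport_iff_eventuallyEq.1 ha⟩ ?_
    rintro p ⟨hp, hpU⟩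
    obtain ⟨R, hR, hRU⟩ := Metric.isOpen_iff.1 hU p hpU
    obtain ⟨q, hq, hqp⟩ := Metric.mem_closure_iff.1 hp R hR
    have hz := eq_zero_on_box h hf hfc hR (fun j x hx => h0 j x (hRU hx))
      (by rwa [Metric.mem_ball, dist_comm]) hq
    filter_upwards [Metric.ball_mem_nhds p hR] with y hy using hz y hy
  exact fun x hx => (hsub hx).self_of_nhds

end System

/-! ### Coordinates of the algebra -/

/-- The left alternative law, linearised. -/
lemma mul_mul_add_mul_mul {A : Type*} [NonAssocRing A] [IsAlternative A] (x y a : A) :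
    x * (y * a) + y * (x * a) = (x * y + y * x) * a := by
  have h := IsAlternative.left_alt (x + y) a
  simp only [add_mul, mul_add, IsAlternative.left_alt] at h
  rw [add_mul]
  have h' : (x * x * a + y * y * a) + (x * (y * a) + y * (x * a)) =
      (x * x * a + y * y * a) + (x * y * a + y * x * a) := by
    rw [show (x * x * a + y * y * a) + (x * (y * a) + y * (x * a)) =
      x * x * a + y * (x * a) + (x * (y * a) + y * y * a) by abel]
    rw [show (x * x * a + y * y * a) + (x * y * a + y * x * a) =
      x * x * a + y * x * a + (x * y * a + y * y * a) by abel]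
    exact h
  exact add_left_cancel h'

section Algebra

variable {A : Type*} [NonAssocRing A] [Module ℝ A]

variable {m d : ℕ} {M : Submodule ℝ A} {v : Fin (m + 1) → A}

section Star

variable [StarRing A]

lemma IsHypercomplexBasis.star_eq_neg (hv : IsHypercomplexBasis M v) {s : Fin (m + 1)}
    (hs : s ≠ 0) : star (v s) = -v s :=
  (neg_eq_of_add_eq_zero_right (hv.mem_imaginaryUnits s hs).1).symm

lemma IsHypercomplexBasis.mul_self (hv : IsHypercomplexBasis M v) {s : Fin (m + 1)}
    (hs : s ≠ 0) : v s * v s = -1 := by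
  have h : v s * star (v s) = 1 := (hv.mem_imaginaryUnits s hs).2
  rw [hv.star_eq_neg hs, mul_neg] at h
  rw [← h, neg_neg]

lemma IsHypercomplexBasis.mul_mul_add [IsAlternative A] (hv : IsHypercomplexBasis M v)
    {r s : Fin (m + 1)} (hr : r ≠ 0) (hs : s ≠ 0) (a : A) :
    v r * (v s * a) + v s * (v r * a) = if r = s then -((2 : ℝ) • a) else 0 := by
  rw [mul_mul_add_mul_mul]
  split_ifs with h
  · subst h
    rw [hv.mul_self hr, two_smul, add_mul, neg_one_mul]
    abel
  · rw [hv.anticomm r s hr hs h, neg_add_cancel, zero_mul]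

lemma IsHypercomplexBasis.star_mul_mul_add [IsAlternative A] (hv : IsHypercomplexBasis M v)
    (r s : Fin (m + 1)) (a : A) :
    star (v r) * (v s * a) + star (v s) * (v r * a) = if r = s then (2 : ℝ) • a else 0 := by
  rcases eq_or_ne r 0 with rfl | hr <;> rcases eq_or_ne s 0 with rfl | hs
  · simp [hv.zero_eq_one, two_smul]
  · simp [hv.zero_eq_one, hv.star_eq_neg hs, hs.symm]
  · simp [hv.zero_eq_one, hv.star_eq_neg hr, hr]
  · have := hv.mul_mul_add hr hs a
    rw [hv.star_eq_neg hr, hv.star_eq_neg hs, neg_mul, neg_mul, ← neg_add, this]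
    split_ifs <;> simp

lemma IsHypercomplexBasis.mul_star_mul_add [IsAlternative A] (hv : IsHypercomplexBasis M v)
    (r s : Fin (m + 1)) (a : A) :
    v r * (star (v s) * a) + v s * (star (v r) * a) = if r = s then (2 : ℝ) • a else 0 := by
  rcases eq_or_ne r 0 with rfl | hr <;> rcases eq_or_ne s 0 with rfl | hs
  · simp [hv.zero_eq_one, two_smul]
  · simp [hv.zero_eq_one, hv.star_eq_neg hs, hs.symm]
  · simp [hv.zero_eq_one, hv.star_eq_neg hr, hr]
  · have := hv.mul_mul_add hr hs a
    rw [hv.star_eq_neg hr, hv.star_eq_neg hs, neg_mul, neg_mul, mul_neg, mul_neg, ← neg_add, this]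
    split_ifs <;> simp

end Star

variable [SMulCommClass ℝ A A] (b : Module.Basis (Fin (d + 1)) ℝ A)

/-- Left multiplication by `a` in the coordinates of the basis `b`. -/
noncomputable def leftMulOp (a : A) : (Fin (d + 1) → ℝ) →L[ℝ] (Fin (d + 1) → ℝ) :=
  LinearMap.toContinuousLinearMap
    (b.equivFun.toLinearMap ∘ₗ LinearMap.mulLeft ℝ a ∘ₗ b.equivFun.symm.toLinearMap)

lemma leftMulOp_equivFun (a x : A) : leftMulOp b a (b.equivFun x) = b.equivFun (a * x) := by
  simp [leftMulOp]

lemma IsHypercomplexBasis.isCliffordPair [StarRing A] [IsAlternative A]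
    (hv : IsHypercomplexBasis M v) :
    IsCliffordPair (fun s => leftMulOp b (v s)) (fun s => leftMulOp b (star (v s))) := by
  constructor
  · intro r s a
    obtain ⟨x, rfl⟩ := b.equivFun.surjective a
    simp only [leftMulOp_equivFun, ← map_add, hv.star_mul_mul_add]
    split_ifs <;> simp
  · intro r s a
    obtain ⟨x, rfl⟩ := b.equivFun.surjective a
    simp only [leftMulOp_equivFun, ← map_add, hv.mul_star_mul_add]
    split_ifs <;> simp

end Algebra

section Coordinates

variable {A : Type*} [NonAssocRing A] [Module ℝ A] {m d n : ℕ}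
  (b : Module.Basis (Fin (d + 1)) ℝ A)

/-- The function `f` in the coordinates of the basis `b`. -/
noncomputable def coordFun (f : HyperSpace n m → A) (x : HyperSpace n m) : Fin (d + 1) → ℝ :=
  b.equivFun (f x)

lemma contDiff_coordFun_iff {k : ℕ∞} {f : HyperSpace n m → A} :
    ContDiff ℝ k (coordFun b f) ↔ IsCk b k f := by
  rw [contDiff_pi]
  rfl

lemma coordFun_eq_zero_iff {f : HyperSpace n m → A} {x : HyperSpace n m} :
    coordFun b f x = 0 ↔ f x = 0 :=
  b.equivFun.map_eq_zero_iff

lemma support_coordFun (f : HyperSpace n m → A) :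
    Function.support (coordFun b f) = Function.support f := by
  ext x
  exact (coordFun_eq_zero_iff b).not

lemma tsupport_coordFun (f : HyperSpace n m → A) : tsupport (coordFun b f) = tsupport f := by
  rw [tsupport, tsupport, support_coordFun]

lemma hasCompactSupport_coordFun_iff {f : HyperSpace n m → A} :
    HasCompactSupport (coordFun b f) ↔ HasCompactSupport f := by
  rw [HasCompactSupport, tsupport_coordFun, HasCompactSupport]

lemma coordFun_injective : Function.Injective (coordFun (n := n) (m := m) b) := fun _ _ h =>
  funext fun x => b.equivFun.injective (congrFun h x)

lemma equivFun_sum_smul (c : Fin (d + 1) → ℝ) : b.equivFun (∑ t, c t • b t) = c := by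
  rw [← b.equivFun_symm_apply, LinearEquiv.apply_symm_apply]

lemma equivFun_partialD (j : Fin n) (s : Fin (m + 1)) {f : HyperSpace n m → A}
    (hf : Differentiable ℝ (coordFun b f)) (x : HyperSpace n m) :
    b.equivFun (partialD b j s f x) =
      dirDeriv (varIncl m j (EuclideanSpace.single s 1)) (coordFun b f) x := by
  rw [partialD, equivFun_sum_smul]
  funext t
  have h1 : HasFDerivAt (coordFun b f) (fderiv ℝ (coordFun b f) x) x := (hf x).hasFDerivAt
  have h2 := (hasFDerivAt_pi'.1 h1 t).hasLineDerivAt (varIncl m j (EuclideanSpace.single s 1))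
  exact h2.lineDeriv

lemma coordFun_partialD (j : Fin n) (s : Fin (m + 1)) {f : HyperSpace n m → A}
    (hf : Differentiable ℝ (coordFun b f)) :
    coordFun b (partialD b j s f) =
      dirDeriv (varIncl m j (EuclideanSpace.single s 1)) (coordFun b f) :=
  funext (equivFun_partialD b j s hf)

lemma coordFun_laplacianAt (j : Fin n) {f : HyperSpace n m → A}
    (hf : ContDiff ℝ 2 (coordFun b f)) :
    coordFun b (laplacianAt b j f) = laplacianOp (varIncl m j) (coordFun b f) := by
  funext x
  rw [coordFun, laplacianAt, map_sum, laplacianOp]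
  refine Finset.sum_congr rfl fun s _ => ?_
  have h1 := coordFun_partialD b j s (hf.differentiable two_ne_zero)
  rw [equivFun_partialD b j s, h1]
  rw [h1]
  exact (hf.dirDeriv (l := 1) (by norm_num) _).differentiable one_ne_zero

variable [SMulCommClass ℝ A A] (v : Fin (m + 1) → A)

lemma coordFun_dirac (j : Fin n) {f : HyperSpace n m → A}
    (hf : Differentiable ℝ (coordFun b f)) :
    coordFun b (dirac b v j f) =
      diracOp (fun s => leftMulOp b (v s)) (varIncl m j) (coordFun b f) := by
  funext x
  rw [coordFun, dirac, map_sum, diracOp]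
  refine Finset.sum_congr rfl fun s _ => ?_
  rw [← leftMulOp_equivFun, equivFun_partialD b j s hf]

variable [StarRing A]

lemma coordFun_conjDirac (j : Fin n) {f : HyperSpace n m → A}
    (hf : Differentiable ℝ (coordFun b f)) :
    coordFun b (conjDirac b v j f) =
      diracOp (fun s => leftMulOp b (star (v s))) (varIncl m j) (coordFun b f) :=
  coordFun_dirac b (fun s => star (v s)) j hf

lemma coordFun_cauchyTransform [StarModule ℝ A] [IsScalarTower ℝ A A] (i : Fin n)
    {g : HyperSpace n m → A} (hg : Continuous (coordFun b g)) (hc : HasCompactSupport g) :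
    coordFun b (cauchyTransform b v i g) =
      cauchyOp (fun s => leftMulOp b (star (v s))) (varIncl m i) (coordFun b g) := by
  funext x
  have hc' := (hasCompactSupport_coordFun_iff b).2 hc
  have hint : ∀ s, Integrable
      (fun y => cauchyComponent m s y • coordFun b g (x + varIncl m i y)) := fun s =>
    integrable_kernelTransform (locallyIntegrable_cauchyComponent m s) (norm_le_norm_varIncl i)
      hg hc' x
  have e : ∀ y, b.equivFun (cauchyKernel v y * g (Function.update x i (y + x i))) =
      ∑ s, leftMulOp b (star (v s))
        (cauchyComponent m s y • coordFun b g (x + varIncl m i y)) := by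
    intro y
    have h1 : cauchyKernel v y = ∑ s, cauchyComponent m s y • star (v s) := by
      simp [cauchyKernel, cauchyComponent, star_sum, Finset.smul_sum, smul_smul]
    rw [h1, Finset.sum_mul, map_sum]
    refine Finset.sum_congr rfl fun s _ => ?_
    rw [map_smul, coordFun, leftMulOp_equivFun, smul_mul_assoc, map_smul, add_varIncl_eq_update]
  have hint' : ∀ s, Integrable (fun y => leftMulOp b (star (v s))
      (cauchyComponent m s y • coordFun b g (x + varIncl m i y))) := fun s =>
    (leftMulOp b (star (v s))).integrable_comp (hint s)
  have hsum := integrable_finsetSum Finset.univ fun s _ => hint' s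
  rw [coordFun, cauchyTransform, integralA, equivFun_sum_smul]
  have e2 : cauchyOp (fun s => leftMulOp b (star (v s))) (varIncl m i) (coordFun b g) x =
      ∫ y, b.equivFun (cauchyKernel v y * g (Function.update x i (y + x i))) := by
    simp only [e]
    rw [integral_finsetSum _ fun s _ => hint' s]
    exact Finset.sum_congr rfl fun s _ =>
      ((leftMulOp b (star (v s))).integral_comp_comm (hint s)).symm
  rw [e2]
  simp only [← e] at hsum
  funext t
  exact (eval_integral (fun t => hsum.eval t) t).symm

end Coordinates

/-! ### The equivalence -/

theorem mainTheorem5 {A : Type*} [NonAssocRing A] [Module ℝ A] [IsScalarTower ℝ A A]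
    [SMulCommClass ℝ A A] [IsAlternative A] [StarRing A] [StarModule ℝ A]
    {m d n : ℕ} (hmd : m ≤ d) (M : Submodule ℝ A) (hM : IsHypercomplexSubspace M)
    (v : Fin (m + 1) → A) (hv : IsHypercomplexBasis M v)
    (b : Module.Basis (Fin (d + 1)) ℝ A)
    (hb : ∀ s : Fin (m + 1), b (Fin.castLE (Nat.succ_le_succ hmd) s) = v s)
    (hn : 1 < n) (k : ℕ∞) (hk : 3 ≤ k)
    (g : Fin n → HyperSpace n m → A) (hg : ∀ j, IsCkCompact b k (g j)) :
    List.TFAE [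
      ∃ f : HyperSpace n m → A, IsCompactSolution b v k g f ∧ VanishesOnUnboundedComponent g f,
      ∀ j : Fin n, j ≠ ⟨0, Nat.zero_lt_of_lt hn⟩ → ∀ x : HyperSpace n m,
        g j x = -dirac b v j
          (cauchyTransform b v ⟨0, Nat.zero_lt_of_lt hn⟩ (g ⟨0, Nat.zero_lt_of_lt hn⟩)) x,
      ∀ (i j : Fin n) (x : HyperSpace n m),
        dirac b v i (conjDirac b v j (g j)) x = laplacianAt b j (g i) x] ∧
    ∀ f : HyperSpace n m → A, IsCompactSolution b v k g f → VanishesOnUnboundedComponent g f := by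
  set i₀ : Fin n := ⟨0, Nat.zero_lt_of_lt hn⟩
  have h := hv.isCliffordPair b
  set L : Fin (m + 1) → (Fin (d + 1) → ℝ) →L[ℝ] (Fin (d + 1) → ℝ) := fun s => leftMulOp b (v s)
  set L' : Fin (m + 1) → (Fin (d + 1) → ℝ) →L[ℝ] (Fin (d + 1) → ℝ) :=
    fun s => leftMulOp b (star (v s))
  let G : Fin n → HyperSpace n m → Fin (d + 1) → ℝ := fun j => coordFun b (g j)
  have h3k : (3 : WithTop ℕ∞) ≤ (k : WithTop ℕ∞) :=
    (WithTop.coe_le_coe.2 hk : ((3 : ℕ∞) : WithTop ℕ∞) ≤ (k : WithTop ℕ∞))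
  have hGk : ∀ j, ContDiff ℝ k (G j) := fun j => (contDiff_coordFun_iff b).2 (hg j).1
  have hG3 : ∀ j, ContDiff ℝ 3 (G j) := fun j => (hGk j).of_le h3k
  have hGc : ∀ j, HasCompactSupport (G j) := fun j => (hasCompactSupport_coordFun_iff b).2 (hg j).2
  have hT : coordFun b (cauchyTransform b v i₀ (g i₀)) = cauchyOp L' (varIncl m i₀) (G i₀) :=
    coordFun_cauchyTransform b v i₀ (hGk i₀).continuous (hg i₀).2
  have hTk : ContDiff ℝ k (cauchyOp L' (varIncl m i₀) (G i₀)) := contDiff_cauchyOp (hGk i₀) (hGc i₀)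
  have hT3 : ContDiff ℝ 3 (cauchyOp L' (varIncl m i₀) (G i₀)) := hTk.of_le h3k
  have hdT : ∀ j, coordFun b (dirac b v j (cauchyTransform b v i₀ (g i₀))) =
      diracOp L (varIncl m j) (cauchyOp L' (varIncl m i₀) (G i₀)) := by
    intro j
    rw [coordFun_dirac b v j, hT]
    rw [hT]
    exact hT3.differentiable (by norm_num)
  -- what it means to be a solution, in coordinates
  have hsol : ∀ f, IsCompactSolution b v k g f → ContDiff ℝ 3 (coordFun b f) ∧
      HasCompactSupport (coordFun b f) ∧ ∀ j, diracOp L (varIncl m j) (coordFun b f) = G j := by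
    rintro f ⟨⟨hf, hfc⟩, hfs⟩
    have hf3 : ContDiff ℝ 3 (coordFun b f) := ((contDiff_coordFun_iff b).2 hf).of_le h3k
    refine ⟨hf3, (hasCompactSupport_coordFun_iff b).2 hfc, fun j => ?_⟩
    rw [← coordFun_dirac b v j (hf3.differentiable (by norm_num)), funext (hfs j)]
  have hvan : ∀ f, IsCompactSolution b v k g f → VanishesOnUnboundedComponent g f := by
    intro f hf x hx hub
    obtain ⟨hf3, hfc, hfs⟩ := hsol f hf
    set K := ⋃ j, tsupport (g j)
    have hK : IsClosed K := isClosed_iUnion_of_finite fun j => isClosed_tsupport (g j)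
    refine (coordFun_eq_zero_iff b).1 (eq_zero_of_isPreconnected_of_not_isBounded h
      (hf3.of_le (by norm_num)) hfc hK.isOpen_compl.connectedComponentIn
      isPreconnected_connectedComponentIn hub (fun j y hy => ?_) x (mem_connectedComponentIn hx))
    rw [hfs j]
    refine (coordFun_eq_zero_iff b).2 (image_eq_zero_of_notMem_tsupport fun hyj => ?_)
    exact connectedComponentIn_subset _ _ hy (Set.mem_iUnion.2 ⟨j, hyj⟩)
  refine ⟨?_, hvan⟩
  tfae_have 1 → 3 := by
    rintro ⟨f, hf, -⟩ i j x
    obtain ⟨hf3, hfc, hfs⟩ := hsol f hf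
    have hD : ContDiff ℝ 2 (coordFun b (conjDirac b v j (g j))) := by
      rw [coordFun_conjDirac b v j ((hG3 j).differentiable (by norm_num))]
      exact (hG3 j).diracOp (by norm_num) _ _
    refine congrFun (coordFun_injective b ?_) x
    rw [coordFun_dirac b v i (hD.differentiable (by norm_num)),
      coordFun_conjDirac b v j ((hG3 j).differentiable (by norm_num)),
      coordFun_laplacianAt b j ((hG3 i).of_le (by norm_num))]
    change diracOp L (varIncl m i) (diracOp L' (varIncl m j) (G j)) =
      laplacianOp (varIncl m j) (G i)
    rw [← hfs i, ← hfs j, diracOp_diracOp_eq_laplacianOp h (hf3.of_le (by norm_num)),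
      diracOp_laplacianOp_comm hf3]
  tfae_have 3 → 2 := by
    intro hcomp j hj x
    have key := diracOp_neg_cauchyOp_of_compatible h hG3 hGc hj hT3 (fun y => by
      have hD : ContDiff ℝ 2 (coordFun b (conjDirac b v j (g j))) := by
        rw [coordFun_conjDirac b v j ((hG3 j).differentiable (by norm_num))]
        exact (hG3 j).diracOp (by norm_num) _ _
      have := congrArg (coordFun b) (funext (hcomp i₀ j))
      rw [coordFun_dirac b v i₀ (hD.differentiable (by norm_num)),
        coordFun_conjDirac b v j ((hG3 j).differentiable (by norm_num)),
        coordFun_laplacianAt b j ((hG3 i₀).of_le (by norm_num))] at this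
      exact congrFun this y) x
    rw [← congrFun (hdT j) x] at key
    refine b.equivFun.injective ?_
    rw [map_neg]
    exact (neg_eq_iff_eq_neg.2 key).symm
  tfae_have 2 → 1 := by
    intro h2
    let f : HyperSpace n m → A := fun x => -cauchyTransform b v i₀ (g i₀) x
    have hfT : coordFun b f = fun x => -cauchyOp L' (varIncl m i₀) (G i₀) x := by
      rw [← hT]
      funext x
      exact map_neg b.equivFun _
    have hfk : ContDiff ℝ k (coordFun b f) := by
      rw [hfT]
      exact hTk.neg
    have hf1 : ContDiff ℝ 1 (coordFun b f) := hfk.of_le (le_trans (by norm_num) h3k)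
    have hfs : ∀ j x, diracOp L (varIncl m j) (coordFun b f) x = G j x := by
      intro j x
      rw [hfT, diracOp_neg]
      rcases eq_or_ne j i₀ with rfl | hj
      · rw [diracOp_cauchyOp h (norm_le_norm_varIncl _) ((hG3 _).of_le (by norm_num)) (hGc _),
          neg_neg]
      · rw [← hdT j]
        exact ((congrArg b.equivFun (h2 j hj x)).trans (map_neg b.equivFun _)).symm
    have hfc : HasCompactSupport (coordFun b f) :=
      hasCompactSupport_of_eq_neg_cauchyOp h hn hGc i₀ hf1 (congrFun hfT) hfs
    have hf : IsCompactSolution b v k g f := by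
      refine ⟨⟨(contDiff_coordFun_iff b).1 hfk, (hasCompactSupport_coordFun_iff b).1 hfc⟩,
        fun j x => congrFun (coordFun_injective b ?_) x⟩
      rw [coordFun_dirac b v j (hf1.differentiable one_ne_zero)]
      exact funext (hfs j)
    exact ⟨f, hf, hvan f hf⟩
  tfae_finish
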